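/- Let $I=[a_0,a_{n+1}]$ with $a_0<a_1<\dots<a_{n+1}$. One of the pieces, $I_h=(a_h,a_{h+1})$ with $0<h<n$, is the hole; the closures of the other $n$ pieces are the laps $L_1,\dots,L_n$ (numbered from left to right, so that $h$ laps lie to the left of the hole). Let $F$ be affine on each lap $L_j$ with slope $s_j$, $|s_j|>1$, and $F(L_j)\subseteq I$; $F$ is undefined on the hole. For $\beta\in\mathbb R$ put $\kappa_j=\operatorname{sign}(s_j)\,|s_j|^{-\beta}$ for a lap $L_j$ and $\kappa_H=0$ for the hole. For a one-sided point $x=c^{\pm}$ let $S_0S_1S_2\dots$ be its itinerary (the symbols of the laps, or $H$ for the hole, that contain the one-sided points $F^k(x)$), let $\tau_k(x)=\prod_{l<k}\kappa_{S_l}$ and let $$\theta_x(t,\beta)=\sum_{k\ge 0}\tau_k(x)\,t^k\,S_k$$ be its weighted invariant coordinate. The weighted kneading increments are $\nu_{a_i}=\theta_{a_i^+}-\theta_{a_i^-}$ for $1\le i\le n$, $i\ne h,h+1$, and $\nu_{a_h}=\theta_{a_h^-}$, $\nu_{a_{h+1}}=\theta_{a_{h+1}^+}$. The weighted kneading determinant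 $D(t,\beta)\in\mathbb R[[t]]$ is the determinant of the $n\times n$ matrix whose $i$-th row consists of the coefficients of $\nu_{a_i}$ at the symbols of the laps $L_1,\dots,L_n$. Suppose that the orbit of each of the $2n$ one-sided end points of the laps ($a_0^+,a_1^-,a_1^+,\dots,a_h^-,a_{h+1}^+,\dots,a_{n+1}^-$) is periodic, eventually periodic, or falls into the hole. Then the set of all points on these orbits is finite, $\{b_0<\dots<b_m\}$. Let $J_i=[b_{i-1},b_i]$, $1\le i\le m$, be the intervals of the resulting Markov partition, and let $Q_\beta$ be the $m\times m$ matrix whose $(i,j)$ entry is $|F'|_{J_j}|^{-\beta}$ if $F(\operatorname{int}J_j)\supseteq\operatorname{int}J_i$, and $0$ otherwise (so a column that belongs to a piece of the hole is $0$). Then, as formal power series in $t$, $$D(t,\beta)=(-1)^{h-1}\,\frac{\det(I-tQ_\beta)}{R(t)}.$$ Here $R(t)$ is the product, over the distinct cycles in which those of the $2n$ orbits that do not fall into the hole end, of the weighted cyclotomic polynomials $$1-\Big(\prod_{l=0}^{q-1}\kappa_{S_{p+l}}\Big)t^{q},$$ where $(S_p\dots S_{p+q-1})^\infty$ is the periodic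 part of the itinerary, $q$ is its minimal period, and two periodic parts that differ by a cyclic shift count as the same cycle. In particular $R(t)$ is invertible in $\mathbb R[[t]]$, and the sign is $+$ if the number $h$ of laps to the left of the hole is odd. -/

import Mathlib

open scoped Polynomial PowerSeries

/-- An expanding piecewise linear map with one hole on the interval `[a 0, a (n+1)]`.
The points `a 0 < a 1 < ⋯ < a (n+1)` cut the interval into `n + 1` pieces.  One of them, neither
the first nor the last, is the hole (an open interval); the other `n` are the laps.  On the lap `j`
(numbered from left to right) the map is `x ↦ slope j * x + intercept j`, with `|slope j| > 1`,
and takes its values in the whole interval. -/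
structure HoleMap (n : ℕ) where
  a : Fin (n + 2) → ℝ
  strictMono_a : StrictMono a
  hole : Fin (n + 1)
  hole_pos : 0 < hole
  hole_lt_last : hole < Fin.last n
  slope : Fin n → ℝ
  intercept : Fin n → ℝ
  one_lt_abs_slope : ∀ j, 1 < |slope j|
  mapsTo : ∀ j, Set.MapsTo (fun x => slope j * x + intercept j)
    (Set.Icc (a (hole.succAbove j).castSucc) (a (hole.succAbove j).succ))
    (Set.Icc (a 0) (a (Fin.last (n + 1))))

namespace HoleMap

noncomputable section

variable {n : ℕ} (F : HoleMap n)

/-- The left end point of the lap `j`. -/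
def left (j : Fin n) : ℝ := F.a (F.hole.succAbove j).castSucc

/-- The right end point of the lap `j`. -/
def right (j : Fin n) : ℝ := F.a (F.hole.succAbove j).succ

/-- The branch of the map on the lap `j`. -/
def branch (j : Fin n) (x : ℝ) : ℝ := F.slope j * x + F.intercept j

/-- The sign of the derivative on the lap `j`. -/
def slopeSign (j : Fin n) : ℤˣ := if 0 < F.slope j then 1 else -1

/-! ### Lateral points

The lateral point `x⁺` (resp. `x⁻`) is the pair `(x, 1)` (resp. `(x, -1)`). -/

/-- The lateral point `p` lies in the lap `j`: the points close to `p.1` on the side `p.2` do. -/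
def InLap (p : ℝ × ℤˣ) (j : Fin n) : Prop :=
  (p.2 = 1 ∧ F.left j ≤ p.1 ∧ p.1 < F.right j) ∨ (p.2 = -1 ∧ F.left j < p.1 ∧ p.1 ≤ F.right j)

open Classical in
/-- The symbol of a lateral point: the lap in which it lies, or `none` (the symbol `H`)
if it lies in the hole. -/
def symbol (p : ℝ × ℤˣ) : Option (Fin n) :=
  if h : ∃ j, F.InLap p j then some h.choose else none

/-- The image of a lateral point: a branch with negative slope exchanges the two sides.
A lateral point in the hole stays where it is; its orbit is over. -/
def step (p : ℝ × ℤˣ) : ℝ × ℤˣ :=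
  match F.symbol p with
  | some j => (F.branch j p.1, F.slopeSign j * p.2)
  | none => p

/-- The symbolic itinerary `S₀ S₁ S₂ …` of a lateral point; `none` is the symbol `H`. -/
def itinerary (p : ℝ × ℤˣ) (k : ℕ) : Option (Fin n) := F.symbol (F.step^[k] p)

/-- The `2 n` lateral limit points of the laps, `a₀⁺, a₁⁻, a₁⁺, …`, without the two that look
into the hole: `(j, 1)` is the left end point of the lap `j`, approached from the right,
and `(j, -1)` is its right end point, approached from the left. -/
def lateral (q : Fin n × ℤˣ) : ℝ × ℤˣ :=
  (if q.2 = 1 then F.left q.1 else F.right q.1, q.2)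

/-- The orbit of the lateral point `p` falls into the hole. -/
def FallsIntoHole (p : ℝ × ℤˣ) : Prop := ∃ k, F.itinerary p k = none

/-- The orbit of the lateral point `p` is periodic (`r = 0`) or eventually periodic. -/
def EventuallyPeriodic (p : ℝ × ℤˣ) : Prop :=
  ∃ r q : ℕ, 0 < q ∧ F.step^[r + q] p = F.step^[r] p

/-! ### The weighted kneading determinant -/

/-- The signed weight `ε |F'| ^ (-β)` of a symbol; it is `0` in the hole. -/
def weight (β : ℝ) : Option (Fin n) → ℝ
  | some j => ((F.slopeSign j : ℤ) : ℝ) * |F.slope j| ^ (-β)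
  | none => 0

/-- `τ_k = ∏_{l < k} ε(S_l) |F'(F^l p)| ^ (-β)`. -/
def tau (β : ℝ) (p : ℝ × ℤˣ) (k : ℕ) : ℝ :=
  ∏ l ∈ Finset.range k, F.weight β (F.itinerary p l)

open Classical in
/-- The weighted invariant coordinate `∑_k τ_k t^k S_k` of a lateral point:
`theta β p j` is its coefficient at the symbol of the lap `j`. -/
def theta (β : ℝ) (p : ℝ × ℤˣ) (j : Fin n) : ℝ⟦X⟧ :=
  PowerSeries.mk fun k => if F.itinerary p k = some j then F.tau β p k else 0

/-- The weighted kneading matrix: the rows are the weighted kneading increments of the interior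
points `a 1, …, a n`, the columns are the symbols of the laps. The increment is `θ(c⁺) - θ(c⁻)`,
except at the left end point of the hole, where it is `θ(c⁻)`, and at the right end point of the
hole, where it is `θ(c⁺)`. -/
def kneadingMatrix (β : ℝ) : Matrix (Fin n) (Fin n) ℝ⟦X⟧ := fun i j =>
  if i.succ.castSucc = F.hole.castSucc then F.theta β (F.a i.succ.castSucc, -1) j
  else if i.succ.castSucc = F.hole.succ then F.theta β (F.a i.succ.castSucc, 1) j
  else F.theta β (F.a i.succ.castSucc, 1) j - F.theta β (F.a i.succ.castSucc, -1) j

/-- The weighted kneading determinant `D(t, β)`, a formal power series in `t`. -/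
def kneadingDet (β : ℝ) : ℝ⟦X⟧ := (F.kneadingMatrix β).det

/-! ### The weighted cyclotomic polynomials -/

/-- The shift on sequences of lap symbols. -/
def shift (w : ℕ → Fin n) : ℕ → Fin n := fun k => w (k + 1)

/-- The periodic symbol sequences in which the itinerary of the lateral point `p` ends:
there are none if the orbit falls into the hole. -/
def periodicTails (p : ℝ × ℤˣ) : Set (ℕ → Fin n) :=
  {w | w ∈ Function.periodicPts (shift (n := n)) ∧
    ∃ r, ∀ l, F.itinerary p (r + l) = some (w l)}

/-- The cycles in which the orbits of the lateral limit points of the laps end (periodic tails up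
to a shift). Two orbits that end in the same cycle give only one element. -/
def cycles : Set (Cycle (ℕ → Fin n)) :=
  ⋃ q : Fin n × ℤˣ, Function.periodicOrbit shift '' F.periodicTails (F.lateral q)

theorem shift_iterate (m : ℕ) (w : ℕ → Fin n) (k : ℕ) : shift^[m] w k = w (k + m) := by
  induction m generalizing w with
  | zero => rfl
  | succ m ih => rw [Function.iterate_succ_apply, ih]; simp only [shift]; congr 1

theorem cycles_finite : F.cycles.Finite := by
  refine Set.finite_iUnion fun q => Set.Subsingleton.finite ?_
  have key : ∀ (w w' : ℕ → Fin n) (r d : ℕ), w ∈ Function.periodicPts (shift (n := n)) →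
      (∀ l, F.itinerary (F.lateral q) (r + l) = some (w l)) →
      (∀ l, F.itinerary (F.lateral q) (r + d + l) = some (w' l)) →
      Function.periodicOrbit shift w = Function.periodicOrbit shift w' := by
    intro w w' r d hw h h'
    have : shift^[d] w = w' := by
      funext l
      rw [shift_iterate]
      have h1 := h (l + d)
      have h2 := h' l
      rw [show r + d + l = r + (l + d) by ring, h1] at h2
      exact Option.some.inj h2
    rw [← this, Function.periodicOrbit_apply_iterate_eq hw]
  rintro _ ⟨w, ⟨hw, r, hr⟩, rfl⟩ _ ⟨w', ⟨hw', r', hr'⟩, rfl⟩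
  rcases le_total r r' with h | h
  · obtain ⟨d, rfl⟩ := Nat.exists_eq_add_of_le h
    exact key w w' r d hw hr hr'
  · obtain ⟨d, rfl⟩ := Nat.exists_eq_add_of_le h
    exact (key w' w r' d hw' hr' hr).symm

/-- The weighted cyclotomic polynomial `1 - (∏ ε |F'| ^ (-β)) t ^ q` of a cycle of length `q`,
the product being taken once around the cycle. -/
def cyclotomic (β : ℝ) (c : Cycle (ℕ → Fin n)) : ℝ[X] :=
  1 - Polynomial.C ((c.toMultiset.map fun w => F.weight β (some (w 0))).prod) *
    Polynomial.X ^ c.length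

/-- `R(t)`: the product of the weighted cyclotomic polynomials of the cycles in which the
orbits of the lateral limit points end, each cycle being counted once. -/
def cyclotomicProduct (β : ℝ) : ℝ[X] := ∏ c ∈ F.cycles_finite.toFinset, F.cyclotomic β c

/-! ### The Markov partition and the weighted transition matrix -/

/-- The points of the orbits of the lateral limit points of the laps. -/
def orbitPoints : Set ℝ := {x | ∃ (q : Fin n × ℤˣ) (k : ℕ), x = (F.step^[k] (F.lateral q)).1}

/-- `b 0 < ⋯ < b m` are the orbit points in increasing order; the intervals
`J i = [b i, b (i+1)]` then form the Markov partition. -/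
def IsMarkovPartition {m : ℕ} (b : Fin (m + 1) → ℝ) : Prop :=
  StrictMono b ∧ Set.range b = F.orbitPoints

/-- The image of a set under the map, which is not defined on the hole. -/
def image (s : Set ℝ) : Set ℝ :=
  {y | ∃ (j : Fin n) (x : ℝ), x ∈ s ∧ x ∈ Set.Icc (F.left j) (F.right j) ∧ y = F.branch j x}

variable {m : ℕ} (b : Fin (m + 1) → ℝ)

/-- The interior of the interval `J i`. -/
def openPiece (i : Fin m) : Set ℝ := Set.Ioo (b i.castSucc) (b i.succ)

open Classical in
/-- The transition matrix: the entry `(i, j)` is `1` if `F (int J j) ⊇ int J i`. -/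
def transitionMatrix : Matrix (Fin m) (Fin m) ℝ := fun i j =>
  if openPiece b i ⊆ F.image (openPiece b j) then 1 else 0

open Classical in
/-- The weight `|F'| ^ (-β)` on the interval `J j`, which is contained in at most one lap
(if it is contained in none, it is a piece of the hole, and the weight is `0`). -/
def pieceWeight (β : ℝ) (j : Fin m) : ℝ :=
  ∑ k : Fin n, if openPiece b j ⊆ Set.Icc (F.left k) (F.right k) then |F.slope k| ^ (-β) else 0

/-- The weighted transition matrix `Q_β`. -/
def weightedTransitionMatrix (β : ℝ) : Matrix (Fin m) (Fin m) ℝ :=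
  F.transitionMatrix b * Matrix.diagonal (F.pieceWeight b β)

end

end HoleMap

/-! ### Determinants -/

/-! Let P be the set of the 2m lateral end points of the Markov intervals. The map acts on the free
module over P by a matrix K, which sends x to κ(x) t times the image of x, and det(1 - K) is a
product over the cycles of this action. A cycle that meets the hole has weight 0 and contributes 1.
In R(t) a cycle of itineraries counts only once, so the action sends both sides of a point to a
common `representative` whenever their itineraries coincide. By expansion an itinerary that avoids
the hole determines the point, so no two periodic points of the action that avoid the hole still
share an itinerary, and det(1 - K) = R(t) (`det_one_sub_lateralMatrix`).

Now take the basis E of P formed by the boundaries of the intervals and the jumps between the two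
sides of the Markov points. Modulo jumps, K acts on the boundaries as tQ. A jump at a point that is
none of the a_k goes to a multiple of the jump at the image point or to 0, and in the first case the
itineraries of the two sides separate earlier; this part is nilpotent. Hence, if the columns of (1 -
K)E at the left ends of the n + 1 pieces are replaced by those of E, the determinant becomes det(1 -
tQ) det E (`det_modified`).

The matrix Θ of invariant coordinates satisfies a recursion which says that Θ(1 - K) consists of the
indicators of the pieces. These vanish on E except on the same n + 1 columns. Therefore det(1 + AB)
= det(1 + BA) reduces the replacement of columns to a determinant of size n + 1
(`det_mul_det_of_selection`), and det(1 - tQ) = R(t) det T, where T contains the increments at the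
left ends of all pieces, with the hole as an additional symbol.

Finally the relation that the sum of (1 - κ_s t) θ_s over all symbols s is 1 eliminates the row of
the hole and the column of a_0 from T. What remains is the transposed kneading matrix with the sign
of the row of a_h reversed, which accounts for the factor (-1)^(h-1). -/

section Determinants

open Matrix Function

variable {R : Type*} [CommRing R]

/-- `det (1 - N) = 1` if `N` strictly decreases a rank function. -/
theorem Matrix.det_one_sub_of_rank {ι : Type*} [Fintype ι] [DecidableEq ι] (N : Matrix ι ι R)
    (r : ι → ℕ) (h : ∀ i j, N i j ≠ 0 → r i < r j) : (1 - N).det = 1 := by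
  have key : ∀ i j, r j ≤ r i → N i j = 0 := fun i j hij => by
    by_contra hne
    exact absurd (h i j hne) (not_lt.mpr hij)
  have hb : BlockTriangular (1 - N) r := fun i j hij => by
    rw [sub_apply, key i j hij.le, one_apply_ne, sub_zero]
    rintro rfl
    exact lt_irrefl _ hij
  rw [hb.det]
  refine Finset.prod_eq_one fun a _ => ?_
  convert! Matrix.det_one (n := {i // r i = a}) (R := R) using 2
  ext ⟨i, hi⟩ ⟨j, hj⟩
  simp [toSquareBlock, toSquareBlockProp, key i j (hj.trans hi.symm).le, one_apply]

/-- The matrix of the weighted map `j ↦ w j • f j`. -/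
def Matrix.ofWeightedMap {X : Type*} [DecidableEq X] (f : X → X) (w : X → R) : Matrix X X R :=
  of fun i j => if i = f j then w j else 0

theorem Matrix.mul_ofWeightedMap_apply {X Y : Type*} [Fintype X] [DecidableEq X] (f : X → X)
    (w : X → R) (M : Matrix Y X R) (i : Y) (j : X) :
    (M * ofWeightedMap f w) i j = M i (f j) * w j := by
  simp [mul_apply, ofWeightedMap]

/-- A suitable combination of the rows is a multiple of the first unit vector; putting it in place
of row 0 leaves a unitriangular matrix. -/
theorem Matrix.det_one_sub_cycle (k : ℕ) (w : ℕ → R) :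
    (1 - ofWeightedMap (fun j : Fin (k + 1) => j + 1) fun j => w j).det =
      1 - ∏ l ∈ Finset.range (k + 1), w l := by
  set M := ofWeightedMap (fun j : Fin (k + 1) => j + 1) fun j => w j with hM
  -- The coefficient at 0 is 1, not the full product, so that replacing row 0 by the combination
  -- does not change the determinant; the full product appears as the defect in column 0.
  let v : Fin (k + 1) → R := fun i => if i = 0 then 1 else ∏ l ∈ Finset.Ico (i : ℕ) (k + 1), w l
  have hrow : ∑ i, v i • (1 - M) i = (1 - ∏ l ∈ Finset.range (k + 1), w l) • Pi.single 0 1 := by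
    have h1 : ∑ i, v i • (1 - M) i = v ᵥ* (1 - M) := by
      ext j; simp [vecMul, dotProduct, Finset.sum_apply]
    have h2 : ∀ j : Fin (k + 1), v (j + 1) = ∏ l ∈ Finset.Ico ((j : ℕ) + 1) (k + 1), w l := by
      intro j
      rcases eq_or_ne j (Fin.last k) with rfl | hj
      · simp [v]
      · have hlt : j < Fin.last k := lt_of_le_of_ne (Fin.le_last j) hj
        have hval : ((j + 1 : Fin (k + 1)) : ℕ) = j + 1 := Fin.val_add_one_of_lt hlt
        have : j + 1 ≠ 0 := fun h => by rw [h] at hval; simp at hval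
        simp only [v, if_neg this, hval]
    rw [h1]
    ext j
    have h3 : (v ᵥ* M) j = v (j + 1) * w j := by
      simp [vecMul, dotProduct, hM, ofWeightedMap]
    rw [vecMul_sub, vecMul_one, Pi.sub_apply, h3, h2]
    rcases eq_or_ne j 0 with rfl | hj
    · simp only [v, if_true, Pi.smul_apply, Pi.single_eq_same, smul_eq_mul, mul_one,
        Finset.range_eq_Ico]
      rw [Finset.prod_eq_prod_Ico_succ_bot (Nat.succ_pos k) w]
      simp [mul_comm]
    · simp only [v, if_neg hj, Pi.smul_apply, Pi.single_eq_of_ne hj, smul_zero]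
      rw [Finset.prod_eq_prod_Ico_succ_bot j.2 w]
      ring
  have h0 := det_updateRow_sum (1 - M) 0 v
  rw [hrow, det_updateRow_smul] at h0
  have hN : (1 - M).updateRow 0 (Pi.single 0 1) = 1 - M.updateRow 0 0 := by
    ext i j
    rcases eq_or_ne i 0 with rfl | hi
    · simp [one_apply, Pi.single_apply, eq_comm]
    · simp [updateRow_ne hi]
  rw [hN, det_one_sub_of_rank _ fun i : Fin (k + 1) => k - (i : ℕ)] at h0
  · simpa [v] using h0.symm
  · intro i j hij
    rcases eq_or_ne i 0 with rfl | hi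
    · simp at hij
    · rw [updateRow_ne hi] at hij
      have hi' : i = j + 1 := by
        by_contra hne
        simp [hM, ofWeightedMap, hne] at hij
      have hlt : j < Fin.last k := by
        refine lt_of_le_of_ne (Fin.le_last j) ?_
        rintro rfl
        simp [hi'] at hi
      have hval := Fin.val_add_one_of_lt hlt
      rw [← hi'] at hval
      have := Fin.lt_def.mp hlt
      simp only [Fin.val_last] at this
      change k - (i : ℕ) < k - j
      omega

open Classical in
/-- The determinant of `1 - M` for a weighted map is a product over the cycles of the map. -/
theorem Matrix.det_one_sub_ofWeightedMap {X : Type*} [Fintype X] [DecidableEq X]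
    (f : X → X) (w : X → R) :
    (1 - ofWeightedMap f w).det =
      ∏ c ∈ (Finset.univ.filter (· ∈ periodicPts f)).image (periodicOrbit f),
        (1 - (c.toMultiset.map w).prod) := by
  set M := ofWeightedMap f w with hM
  let orb : X → Set X := fun x => Set.range fun k => f^[k] x
  have orb_self : ∀ x, x ∈ orb x := fun x => ⟨0, rfl⟩
  have orb_sub : ∀ x, orb (f x) ⊆ orb x := by
    rintro x _ ⟨k, rfl⟩
    exact ⟨k + 1, rfl⟩
  -- Forward orbits shrink along `f`, so a linear extension of inclusion makes `1 - M` block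
  -- triangular. Two points have the same forward orbit only if they are equal or lie on the same
  -- cycle.
  let b : X → LinearExtension (Set X) := fun x => toLinearExtension (orb x)
  have b_inj : ∀ {s t : Set X}, toLinearExtension s = toLinearExtension t → s = t := fun h => h
  have hne : ∀ i j, i ≠ f j → M i j = 0 := fun i j h => by simp [hM, ofWeightedMap, h]
  have hb : BlockTriangular (1 - M) b := fun i j hij => by
    rw [sub_apply, one_apply_ne, hne, sub_zero]
    · rintro rfl
      exact absurd (toLinearExtension.monotone (orb_sub j)) (not_le.mpr hij)
    · rintro rfl
      exact lt_irrefl _ hij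
  rw [hb.det]
  have orbit_set : ∀ x ∈ periodicPts f, {y | y ∈ periodicOrbit f x} = orb x := by
    intro x hx
    ext y
    simp [orb, mem_periodicOrbit_iff hx]
  symm
  refine Finset.prod_of_injOn (fun c => toLinearExtension {x | x ∈ c}) ?_ ?_ ?_ ?_
  · rintro c hc c' hc' h
    simp only [Finset.coe_image, Finset.coe_filter, Finset.mem_univ, true_and, Set.mem_image,
      Set.mem_ofPred_eq] at hc hc'
    obtain ⟨x, hx, rfl⟩ := hc
    obtain ⟨y, hy, rfl⟩ := hc'
    have h' := b_inj h
    have hxy : x ∈ {z | z ∈ periodicOrbit f y} := h' ▸ self_mem_periodicOrbit hx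
    obtain ⟨k, rfl⟩ := (mem_periodicOrbit_iff hy).mp hxy
    exact periodicOrbit_apply_iterate_eq hy k
  · rintro c hc
    simp only [Finset.coe_image, Finset.coe_filter, Finset.mem_univ, true_and, Set.mem_image,
      Set.mem_ofPred_eq] at hc
    obtain ⟨x, hx, rfl⟩ := hc
    simp only [Finset.coe_image, Finset.coe_univ, Set.image_univ, Set.mem_range]
    exact ⟨x, by simp only [b, orbit_set x hx]⟩
  · intro a ha hna
    obtain ⟨x, -, rfl⟩ := Finset.mem_image.mp ha
    have hx : x ∉ periodicPts f := by
      intro hx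
      refine hna ⟨periodicOrbit f x, ?_, ?_⟩
      · simpa using ⟨x, hx, rfl⟩
      · simp only [b, orbit_set x hx]
    have huniq : ∀ y, b y = b x → y = x := by
      intro y hy
      have h := b_inj hy
      obtain ⟨k, hk⟩ : y ∈ orb x := h ▸ orb_self y
      obtain ⟨l, hl⟩ : x ∈ orb y := h ▸ orb_self x
      simp only at hk hl
      by_contra hyx
      have hk0 : 0 < k := by
        rcases Nat.eq_zero_or_pos k with rfl | h0
        · exact absurd hk.symm hyx
        · exact h0
      refine hx ⟨l + k, by omega, ?_⟩
      rw [IsPeriodicPt, IsFixedPt, iterate_add_apply, hk, hl]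
    convert! Matrix.det_one (n := {i // b i = b x}) (R := R) using 2
    ext ⟨i, hi⟩ ⟨j, hj⟩
    obtain rfl := huniq i hi
    obtain rfl := huniq j hj
    have : j ≠ f j := fun h => hx ⟨1, one_pos, h.symm⟩
    simp [toSquareBlock, toSquareBlockProp, hne j j this]
  · intro c hc
    simp only [Finset.mem_image, Finset.mem_filter, Finset.mem_univ, true_and] at hc
    obtain ⟨x, hx, rfl⟩ := hc
    obtain ⟨k, hk⟩ : ∃ k, minimalPeriod f x = k + 1 :=
      Nat.exists_eq_succ_of_ne_zero (minimalPeriod_pos_of_mem_periodicPts hx).ne'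
    have hper : f^[k + 1] x = x := hk ▸ isPeriodicPt_minimalPeriod f x
    have hmem : ∀ i : ℕ, b (f^[i] x) = toLinearExtension {y | y ∈ periodicOrbit f x} := by
      intro i
      rw [← periodicOrbit_apply_iterate_eq hx i, orbit_set]
      obtain ⟨q, hq, hq'⟩ := hx
      exact ⟨q, hq, hq'.apply_iterate i⟩
    let e0 : Fin (k + 1) → {y // b y = toLinearExtension {y | y ∈ periodicOrbit f x}} :=
      fun i => ⟨f^[(i : ℕ)] x, hmem i⟩
    have hbij : Bijective e0 := by
      constructor
      · intro i j hij
        have h : f^[(i : ℕ)] x = f^[(j : ℕ)] x := congrArg Subtype.val hij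
        exact Fin.ext ((iterate_eq_iterate_iff_of_lt_minimalPeriod (i.2.trans_eq hk.symm)
          (j.2.trans_eq hk.symm)).mp h)
      · rintro ⟨y, hy⟩
        have h1 : y ∈ {y | y ∈ periodicOrbit f x} := b_inj hy ▸ orb_self y
        obtain ⟨l, rfl⟩ := (mem_periodicOrbit_iff hx).mp h1
        refine ⟨⟨l % (k + 1), Nat.mod_lt _ (Nat.succ_pos k)⟩, Subtype.ext ?_⟩
        simp only [e0]
        rw [← hk, iterate_mod_minimalPeriod_eq]
    rw [← det_submatrix_equiv_self (Equiv.ofBijective e0 hbij)]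
    have hsub : ((1 - M).toSquareBlock b (toLinearExtension {y | y ∈ periodicOrbit f x})).submatrix
        (Equiv.ofBijective e0 hbij) (Equiv.ofBijective e0 hbij) =
        1 - ofWeightedMap (fun j : Fin (k + 1) => j + 1) fun j => (fun l => w (f^[l] x)) j := by
      ext i j
      have hfj : f (e0 j).1 = (e0 (j + 1)).1 := by
        simp only [e0]
        rcases eq_or_ne j (Fin.last k) with rfl | hj
        · simp [← iterate_succ_apply' f, hper]
        · rw [Fin.val_add_one_of_lt (lt_of_le_of_ne (Fin.le_last j) hj), iterate_succ_apply']
      have h1 : ((e0 i).1 = (e0 j).1) = (i = j) := by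
        rw [← Subtype.ext_iff, hbij.1.eq_iff]
      have h2 : ((e0 i).1 = f (e0 j).1) = (i = j + 1) := by
        rw [hfj, ← Subtype.ext_iff, hbij.1.eq_iff]
      change (1 - M) (e0 i).1 (e0 j).1 = _
      simp only [sub_apply, hM, ofWeightedMap, of_apply, one_apply, h1, h2, e0]
    refine Eq.trans ?_ (congrArg det hsub).symm
    refine Eq.trans ?_ (det_one_sub_cycle k fun l => w (f^[l] x)).symm
    rw [periodicOrbit_def, hk, Cycle.coe_toMultiset, Multiset.map_coe, List.map_map]
    rfl

/-- Replacing the columns of `(1 - K) * E` that are selected by `Sel` by those of `E`. -/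
theorem Matrix.det_mul_det_of_selection {P A : Type*} [Fintype P] [DecidableEq P]
    [Fintype A] [DecidableEq A] (K E : Matrix P P R) (Sel : Matrix A P R)
    (Θ : Matrix A P R) (hE : IsUnit E.det) (hK : IsUnit (1 - K).det)
    (hU : Θ * (1 - K) * E * Selᵀ * Sel = Θ * (1 - K) * E) :
    (Θ * (1 - K) * E * Selᵀ).det * ((1 - K) * E + K * E * Selᵀ * Sel).det =
      (1 - K).det * E.det * (Θ * E * Selᵀ).det := by
  set H := (1 - K) * E with hH
  have hHu : IsUnit H.det := by rw [hH, det_mul]; exact hK.mul hE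
  -- After this factorization `det_one_add_mul_comm` passes to matrices over `A`. There `hU` lets
  -- `Selᵀ * Sel` be absorbed by `Θ * H`, and `Θ * H` plus `Θ * K * E` is `Θ * E`.
  have h1 : H + K * E * Selᵀ * Sel = H * (1 + (H⁻¹ * (K * E * Selᵀ)) * Sel) := by
    rw [Matrix.mul_add, Matrix.mul_one, ← Matrix.mul_assoc, ← Matrix.mul_assoc,
      mul_nonsing_inv _ hHu, Matrix.one_mul]
  have h2 : Θ * (1 - K) * E * Selᵀ * (1 + Sel * (H⁻¹ * (K * E * Selᵀ))) = Θ * E * Selᵀ := by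
    rw [Matrix.mul_add, Matrix.mul_one, ← Matrix.mul_assoc _ Sel, hU, Matrix.mul_assoc Θ _ E, ← hH,
      Matrix.mul_assoc Θ H (H⁻¹ * _), ← Matrix.mul_assoc H, mul_nonsing_inv _ hHu, Matrix.one_mul,
      Matrix.mul_assoc Θ H, ← Matrix.mul_add, ← Matrix.add_mul, hH, ← Matrix.add_mul,
      sub_add_cancel, Matrix.one_mul, Matrix.mul_assoc]
  rw [h1, det_mul, det_one_add_mul_comm, mul_left_comm, ← det_mul, h2, hH, det_mul]

end Determinants

namespace HoleMap

noncomputable section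

variable {n : ℕ} (F : HoleMap n)

/-! ### Lateral points and itineraries -/

/-- The lateral point `p` lies in the piece `k` of the interval (a lap or the hole). -/
def InPiece (p : ℝ × ℤˣ) (k : Fin (n + 1)) : Prop :=
  (p.2 = 1 ∧ F.a k.castSucc ≤ p.1 ∧ p.1 < F.a k.succ) ∨
    (p.2 = -1 ∧ F.a k.castSucc < p.1 ∧ p.1 ≤ F.a k.succ)

/-- The lateral point `p` looks into the whole interval. -/
def Inside (p : ℝ × ℤˣ) : Prop :=
  (p.2 = 1 ∧ F.a 0 ≤ p.1 ∧ p.1 < F.a (Fin.last (n + 1))) ∨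
    (p.2 = -1 ∧ F.a 0 < p.1 ∧ p.1 ≤ F.a (Fin.last (n + 1)))

variable {F}

theorem InPiece.unique {p : ℝ × ℤˣ} {k l : Fin (n + 1)} (hk : F.InPiece p k)
    (hl : F.InPiece p l) : k = l := by
  have key : ∀ {k l : Fin (n + 1)}, F.InPiece p k → F.InPiece p l → ¬k < l := by
    intro k l hk hl hkl
    have h : F.a k.succ ≤ F.a l.castSucc := F.strictMono_a.monotone (by
      rw [Fin.le_def]; simpa using hkl)
    rcases hk with ⟨h1, h2, h3⟩ | ⟨h1, h2, h3⟩ <;> rcases hl with ⟨h4, h5, h6⟩ | ⟨h4, h5, h6⟩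
    · linarith
    · rw [h1] at h4; exact absurd h4 (by decide)
    · rw [h1] at h4; exact absurd h4 (by decide)
    · linarith
  exact le_antisymm (not_lt.mp (key hl hk)) (not_lt.mp (key hk hl))

theorem InLap.inPiece {p : ℝ × ℤˣ} {j : Fin n} (h : F.InLap p j) :
    F.InPiece p (F.hole.succAbove j) := h

theorem InLap.unique {p : ℝ × ℤˣ} {i j : Fin n} (hi : F.InLap p i) (hj : F.InLap p j) : i = j :=
  Fin.succAbove_right_injective (hi.inPiece.unique hj.inPiece)

theorem InLap.mem_Icc {p : ℝ × ℤˣ} {j : Fin n} (h : F.InLap p j) :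
    p.1 ∈ Set.Icc (F.left j) (F.right j) := by
  rcases h with ⟨-, h1, h2⟩ | ⟨-, h1, h2⟩
  exacts [⟨h1, h2.le⟩, ⟨h1.le, h2⟩]

theorem symbol_eq_some_iff {p : ℝ × ℤˣ} {j : Fin n} : F.symbol p = some j ↔ F.InLap p j := by
  unfold symbol
  constructor
  · intro h
    split_ifs at h with hex
    exact Option.some.inj h ▸ hex.choose_spec
  · intro h
    have hex : ∃ j, F.InLap p j := ⟨j, h⟩
    rw [dif_pos hex, hex.choose_spec.unique h]

theorem symbol_eq_none_iff {p : ℝ × ℤˣ} : F.symbol p = none ↔ ∀ j, ¬F.InLap p j := by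
  rw [Option.eq_none_iff_forall_ne_some]
  simp only [ne_eq, symbol_eq_some_iff]

theorem InPiece.symbol_eq {p : ℝ × ℤˣ} {k : Fin (n + 1)} (h : F.InPiece p k) :
    F.symbol p = finSuccEquiv' F.hole k := by
  rcases Fin.eq_self_or_eq_succAbove F.hole k with rfl | ⟨j, rfl⟩
  · rw [finSuccEquiv'_at, symbol_eq_none_iff]
    intro j hj
    exact Fin.succAbove_ne _ _ (hj.inPiece.unique h)
  · rw [finSuccEquiv'_succAbove]
    exact symbol_eq_some_iff.mpr h

theorem step_of_some {p : ℝ × ℤˣ} {j : Fin n} (h : F.symbol p = some j) :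
    F.step p = (F.branch j p.1, F.slopeSign j * p.2) := by
  simp [step, h]

theorem step_of_none {p : ℝ × ℤˣ} (h : F.symbol p = none) : F.step p = p := by
  simp [step, h]

theorem itinerary_zero (p : ℝ × ℤˣ) : F.itinerary p 0 = F.symbol p := rfl

theorem itinerary_succ (p : ℝ × ℤˣ) (k : ℕ) :
    F.itinerary p (k + 1) = F.itinerary (F.step p) k := rfl

theorem itinerary_add (p : ℝ × ℤˣ) (k l : ℕ) :
    F.itinerary p (k + l) = F.itinerary (F.step^[k] p) l := by
  rw [itinerary, itinerary, add_comm, Function.iterate_add_apply]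

theorem itinerary_of_none {p : ℝ × ℤˣ} (h : F.symbol p = none) (k : ℕ) :
    F.itinerary p k = none := by
  rw [itinerary, Function.iterate_fixed (step_of_none h), h]

theorem slopeSign_eq_one {j : Fin n} (h : 0 < F.slope j) : F.slopeSign j = 1 := if_pos h

theorem slopeSign_eq_neg_one {j : Fin n} (h : F.slope j < 0) : F.slopeSign j = -1 :=
  if_neg h.not_gt

variable (F)

theorem slope_ne_zero (j : Fin n) : F.slope j ≠ 0 := by
  have h := F.one_lt_abs_slope j
  intro h0
  rw [h0, abs_zero] at h
  linarith

theorem left_lt_right (j : Fin n) : F.left j < F.right j :=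
  F.strictMono_a Fin.castSucc_lt_succ

theorem branch_sub (j : Fin n) (x y : ℝ) :
    F.branch j x - F.branch j y = F.slope j * (x - y) := by
  unfold branch; ring

variable {F}

theorem InLap.inside_step {p : ℝ × ℤˣ} {j : Fin n} (h : F.InLap p j) :
    F.Inside (F.branch j p.1, F.slopeSign j * p.2) := by
  have hl := F.mapsTo j ⟨le_rfl, (F.left_lt_right j).le⟩
  have hr := F.mapsTo j ⟨(F.left_lt_right j).le, le_rfl⟩
  change F.branch j (F.left j) ∈ _ at hl
  change F.branch j (F.right j) ∈ _ at hr
  have hx : F.branch j p.1 ∈ Set.Icc (F.a 0) (F.a (Fin.last (n + 1))) := F.mapsTo j h.mem_Icc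
  have h1 := F.branch_sub j p.1 (F.left j)
  have h2 := F.branch_sub j (F.right j) p.1
  rcases lt_or_gt_of_ne (F.slope_ne_zero j) with hs | hs
  · rw [slopeSign_eq_neg_one hs]
    rcases h with ⟨hp, h3, h4⟩ | ⟨hp, h3, h4⟩
    · refine Or.inr ⟨by simp [hp], ?_, hx.2⟩
      have := mul_neg_of_neg_of_pos hs (sub_pos.mpr h4)
      change F.a 0 < F.branch j p.1
      linarith [hr.1]
    · refine Or.inl ⟨by simp [hp], hx.1, ?_⟩
      have := mul_neg_of_neg_of_pos hs (sub_pos.mpr h3)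
      change F.branch j p.1 < _
      linarith [hl.2]
  · rw [slopeSign_eq_one hs]
    rcases h with ⟨hp, h3, h4⟩ | ⟨hp, h3, h4⟩
    · refine Or.inl ⟨by simp [hp], hx.1, ?_⟩
      have := mul_pos hs (sub_pos.mpr h4)
      change F.branch j p.1 < _
      linarith [hr.2]
    · refine Or.inr ⟨by simp [hp], ?_, hx.2⟩
      have := mul_pos hs (sub_pos.mpr h3)
      change F.a 0 < F.branch j p.1
      linarith [hl.1]

theorem Inside.step {p : ℝ × ℤˣ} (h : F.Inside p) : F.Inside (F.step p) := by
  rcases hs : F.symbol p with _ | j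
  · rwa [step_of_none hs]
  · rw [step_of_some hs]
    exact (symbol_eq_some_iff.mp hs).inside_step

theorem Inside.mem_Icc {p : ℝ × ℤˣ} (h : F.Inside p) :
    p.1 ∈ Set.Icc (F.a 0) (F.a (Fin.last (n + 1))) := by
  rcases h with ⟨-, h1, h2⟩ | ⟨-, h1, h2⟩
  exacts [⟨h1, h2.le⟩, ⟨h1.le, h2⟩]

theorem Inside.iterate_step {p : ℝ × ℤˣ} (h : F.Inside p) (k : ℕ) : F.Inside (F.step^[k] p) := by
  induction k with
  | zero => exact h
  | succ k ih => rw [Function.iterate_succ_apply']; exact ih.step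

theorem InLap.inside {p : ℝ × ℤˣ} {j : Fin n} (h : F.InLap p j) : F.Inside p := by
  have h0 : F.a 0 ≤ F.left j := F.strictMono_a.monotone (Fin.zero_le _)
  have h1 : F.right j ≤ F.a (Fin.last (n + 1)) := F.strictMono_a.monotone (Fin.le_last _)
  rcases h with ⟨h2, h3, h4⟩ | ⟨h2, h3, h4⟩
  · exact Or.inl ⟨h2, h0.trans h3, h4.trans_le h1⟩
  · exact Or.inr ⟨h2, h0.trans_lt h3, h4.trans h1⟩

variable (F)

theorem inLap_lateral (q : Fin n × ℤˣ) : F.InLap (F.lateral q) q.1 := by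
  have h := F.left_lt_right q.1
  rcases Int.units_eq_one_or q.2 with hq | hq
  · exact Or.inl ⟨hq, by simp [lateral, hq], by simpa [lateral, hq] using h⟩
  · exact Or.inr ⟨hq, by simpa [lateral, hq] using h, by simp [lateral, hq]⟩

variable {F}

theorem InLap.eq_lateral {p : ℝ × ℤˣ} {j : Fin n} (h : F.InLap p j)
    (h' : ¬F.InLap (p.1, -p.2) j) : p = F.lateral (j, p.2) := by
  refine Prod.ext ?_ rfl
  rcases h with ⟨h1, h2, h3⟩ | ⟨h1, h2, h3⟩
  · simp only [lateral, h1, if_true]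
    by_contra hne
    exact h' (Or.inr ⟨by simp [h1], lt_of_le_of_ne h2 (Ne.symm hne), h3.le⟩)
  · rw [lateral]
    simp only [h1, if_neg (show (-1 : ℤˣ) ≠ 1 by decide)]
    by_contra hne
    exact h' (Or.inl ⟨by simp [h1], h2.le, lt_of_le_of_ne h3 hne⟩)

theorem symbol_sides {x : ℝ} (hx : x ∉ Set.range F.a) :
    F.symbol (x, 1) = F.symbol (x, -1) := by
  have h : ∀ j, F.InLap (x, 1) j ↔ F.InLap (x, -1) j := by
    intro j
    have hl : F.left j ≠ x := fun h => hx ⟨_, h⟩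
    have hr : x ≠ F.right j := fun h => hx ⟨_, h.symm⟩
    have h1 : (1 : ℤˣ) ≠ -1 := by decide
    simp only [InLap, true_and, h1, h1.symm, false_and, or_false, false_or]
    exact ⟨fun h => ⟨lt_of_le_of_ne h.1 hl, h.2.le⟩, fun h => ⟨h.1.le, lt_of_le_of_ne h.2 hr⟩⟩
  rcases hs : F.symbol (x, -1) with _ | j
  · rw [symbol_eq_none_iff] at hs ⊢
    exact fun j hj => hs j ((h j).mp hj)
  · rw [symbol_eq_some_iff] at hs ⊢
    exact (h j).mpr hs

/-- Two points that pass through the same laps are driven apart at least by the smallest slope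
modulus, which exceeds 1, at every step, while both stay in a bounded interval. -/
theorem eq_of_itinerary_eq {p p' : ℝ × ℤˣ} (h : F.itinerary p = F.itinerary p')
    (hp : ∀ k, F.itinerary p k ≠ none) : p.1 = p'.1 := by
  obtain ⟨j0, hj0⟩ := Option.ne_none_iff_exists'.mp (hp 0)
  have : Nonempty (Fin n) := ⟨j0⟩
  obtain ⟨i, hi⟩ := Finite.exists_min fun j => |F.slope j|
  have hin : ∀ k, ∃ j, F.InLap (F.step^[k] p) j ∧ F.InLap (F.step^[k] p') j := by
    intro k
    obtain ⟨j, hj⟩ := Option.ne_none_iff_exists'.mp (hp k)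
    exact ⟨j, symbol_eq_some_iff.mp hj, symbol_eq_some_iff.mp ((congrFun h k).symm.trans hj)⟩
  have hexp : ∀ k, |F.slope i| ^ k * |p.1 - p'.1| ≤ |(F.step^[k] p).1 - (F.step^[k] p').1| := by
    intro k
    induction k with
    | zero => simp
    | succ k ih =>
      obtain ⟨j, h1, h2⟩ := hin k
      rw [Function.iterate_succ_apply', Function.iterate_succ_apply',
        step_of_some (symbol_eq_some_iff.mpr h1), step_of_some (symbol_eq_some_iff.mpr h2)]
      simp only
      rw [branch_sub, abs_mul, pow_succ', mul_assoc]
      exact mul_le_mul (hi j) ih (by positivity) (abs_nonneg _)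
  by_contra hne
  have hpos : 0 < |p.1 - p'.1| := abs_pos.mpr (sub_ne_zero.mpr hne)
  obtain ⟨k, hk⟩ := pow_unbounded_of_one_lt ((F.a (Fin.last (n + 1)) - F.a 0) / |p.1 - p'.1|)
    (F.one_lt_abs_slope i)
  rw [div_lt_iff₀ hpos] at hk
  obtain ⟨j, h1, h2⟩ := hin k
  have h3 := h1.inside.mem_Icc
  have h4 := h2.inside.mem_Icc
  have h5 : |(F.step^[k] p).1 - (F.step^[k] p').1| ≤ F.a (Fin.last (n + 1)) - F.a 0 :=
    abs_sub_le_iff.mpr ⟨by linarith [h3.2, h4.1], by linarith [h3.1, h4.2]⟩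
  linarith [hexp k]

/-! ### Points whose two sides have the same itinerary -/

variable (F)

/-- Both sides of the point `x` have the same itinerary. -/
def SidesAgree (x : ℝ) : Prop := F.itinerary (x, 1) = F.itinerary (x, -1)

open Classical in
/-- A common representative of the two sides of a point where they have the same itinerary. -/
def representative (p : ℝ × ℤˣ) : ℝ × ℤˣ := if F.SidesAgree p.1 then (p.1, -1) else p

theorem representative_fst (p : ℝ × ℤˣ) : (F.representative p).1 = p.1 := by
  unfold representative; split_ifs <;> rfl

theorem itinerary_representative (p : ℝ × ℤˣ) :
    F.itinerary (F.representative p) = F.itinerary p := by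
  unfold representative
  split_ifs with h
  · obtain ⟨x, s⟩ := p
    rcases Int.units_eq_one_or s with rfl | rfl
    · exact h.symm
    · rfl
  · rfl

theorem representative_representative (p : ℝ × ℤˣ) :
    F.representative (F.representative p) = F.representative p := by
  by_cases h : F.SidesAgree p.1 <;> simp [representative, h]

variable {F}

theorem step_side {x : ℝ} {j : Fin n} (h1 : F.symbol (x, 1) = some j)
    (h2 : F.symbol (x, -1) = some j) :
    (F.step (x, 1) = (F.branch j x, 1) ∧ F.step (x, -1) = (F.branch j x, -1)) ∨
      (F.step (x, 1) = (F.branch j x, -1) ∧ F.step (x, -1) = (F.branch j x, 1)) := by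
  rw [step_of_some h1, step_of_some h2]
  rcases Int.units_eq_one_or (F.slopeSign j) with h | h <;> simp [h]

theorem itinerary_branch_sides {x : ℝ} {j : Fin n} (h1 : F.symbol (x, 1) = some j)
    (h2 : F.symbol (x, -1) = some j) (k : ℕ) :
    F.itinerary (F.branch j x, 1) k = F.itinerary (F.branch j x, -1) k ↔
      F.itinerary (x, 1) (k + 1) = F.itinerary (x, -1) (k + 1) := by
  rw [itinerary_succ, itinerary_succ]
  rcases step_side h1 h2 with ⟨h3, h4⟩ | ⟨h3, h4⟩ <;> rw [h3, h4]
  exact eq_comm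

theorem sidesAgree_branch_iff {x : ℝ} {j : Fin n} (h1 : F.symbol (x, 1) = some j)
    (h2 : F.symbol (x, -1) = some j) : F.SidesAgree (F.branch j x) ↔ F.SidesAgree x := by
  simp only [SidesAgree, funext_iff, itinerary_branch_sides h1 h2]
  refine ⟨fun h k => ?_, fun h k => h (k + 1)⟩
  cases k with
  | zero => rw [itinerary_zero, itinerary_zero, h1, h2]
  | succ k => exact h k

/-- Because of the identification of sides, the jump at a point whose sides never separate is sent
to 0. Without it, such jumps could form cycles and spoil nilpotency. -/
theorem SidesAgree.representative_step {x : ℝ} {j : Fin n} (h : F.SidesAgree x)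
    (h1 : F.symbol (x, 1) = some j) :
    F.representative (F.step (x, 1)) = F.representative (F.step (x, -1)) := by
  have h2 : F.symbol (x, -1) = some j := (congrFun h 0).symm.trans h1
  have h3 := (sidesAgree_branch_iff h1 h2).mpr h
  rcases step_side h1 h2 with ⟨h4, h5⟩ | ⟨h4, h5⟩ <;> simp [h4, h5, representative, h3]

variable (F)

theorem inPiece_castSucc (k : Fin (n + 1)) : F.InPiece (F.a k.castSucc, 1) k :=
  Or.inl ⟨rfl, le_rfl, F.strictMono_a Fin.castSucc_lt_succ⟩

theorem inPiece_succ (k : Fin (n + 1)) : F.InPiece (F.a k.succ, -1) k :=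
  Or.inr ⟨rfl, F.strictMono_a Fin.castSucc_lt_succ, le_rfl⟩

/-- A point where both sides agree is interior. -/
theorem SidesAgree.mem_Ioo {x : ℝ} (h : F.SidesAgree x)
    (hx : x ∈ Set.Icc (F.a 0) (F.a (Fin.last (n + 1)))) :
    x ∈ Set.Ioo (F.a 0) (F.a (Fin.last (n + 1))) := by
  have h0 : F.symbol (x, 1) = F.symbol (x, -1) := congrFun h 0
  have h1 : (1 : ℤˣ) ≠ -1 := by decide
  refine ⟨lt_of_le_of_ne hx.1 ?_, lt_of_le_of_ne hx.2 ?_⟩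
  · rintro rfl
    -- The first piece is not the hole, so the inner side of `a 0` lies in a lap, whereas the outer
    -- side lies in none.
    obtain ⟨j, hj⟩ := Fin.exists_succAbove_eq F.hole_pos.ne
    have h2 := (F.inPiece_castSucc 0).symbol_eq
    rw [Fin.castSucc_zero, ← hj, finSuccEquiv'_succAbove, h0, symbol_eq_some_iff] at h2
    rcases h2.inside with ⟨h3, -⟩ | ⟨-, h3, -⟩
    · exact h1 h3.symm
    · exact lt_irrefl _ h3
  · rintro rfl
    obtain ⟨j, hj⟩ := Fin.exists_succAbove_eq F.hole_lt_last.ne'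
    have h2 := (F.inPiece_succ (Fin.last n)).symbol_eq
    rw [Fin.succ_last, ← hj, finSuccEquiv'_succAbove, ← h0, symbol_eq_some_iff] at h2
    rcases h2.inside with ⟨-, -, h3⟩ | ⟨h3, -⟩
    · exact lt_irrefl _ h3
    · exact h1 h3

variable {F}

theorem Inside.representative {p : ℝ × ℤˣ} (h : F.Inside p) : F.Inside (F.representative p) := by
  unfold HoleMap.representative
  split_ifs with hs
  · have := hs.mem_Ioo F h.mem_Icc
    exact Or.inr ⟨rfl, this.1, this.2.le⟩
  · exact h

/-- If the sides of `x` have different itineraries, then an orbit which avoids the hole and starts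
at one of them hits a lateral end point of a lap. -/
theorem exists_iterate_eq_lateral {p : ℝ × ℤˣ} (h : ¬F.SidesAgree p.1)
    (hp : ∀ k, F.itinerary p k ≠ none) : ∃ k q, F.step^[k] p = F.lateral q := by
  classical
  have hne : ∃ k, F.itinerary p k ≠ F.itinerary (p.1, -p.2) k := by
    by_contra! hcon
    refine h ?_
    obtain ⟨x, s⟩ := p
    rcases Int.units_eq_one_or s with rfl | rfl
    · exact funext hcon
    · exact (funext fun k => by simpa using (hcon k).symm)
  obtain ⟨k, hk, hmin⟩ : ∃ k, F.itinerary p k ≠ F.itinerary (p.1, -p.2) k ∧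
      ∀ l < k, F.itinerary p l = F.itinerary (p.1, -p.2) l :=
    ⟨Nat.find hne, Nat.find_spec hne, fun l hl => not_not.mp (Nat.find_min hne hl)⟩
  -- Up to the first time `k` of disagreement both sides use the same branches, so they remain the
  -- two sides of one point. At time `k` one side is in a lap that does not contain the other, hence
  -- it is an end of that lap.
  have hstep : ∀ l ≤ k, F.step^[l] (p.1, -p.2) = ((F.step^[l] p).1, -(F.step^[l] p).2) := by
    intro l
    induction l with
    | zero => intro _; rfl
    | succ l ih =>
      intro hl
      have ih := ih (by omega)
      obtain ⟨j, hj⟩ := Option.ne_none_iff_exists'.mp (hp l)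
      have hj' := (hmin l (by omega)).symm.trans hj
      rw [itinerary] at hj hj'
      rw [Function.iterate_succ_apply', Function.iterate_succ_apply', step_of_some hj,
        step_of_some hj', ih]
      simp
  obtain ⟨j, hj⟩ := Option.ne_none_iff_exists'.mp (hp k)
  refine ⟨k, (j, (F.step^[k] p).2), (symbol_eq_some_iff.mp hj).eq_lateral fun hcon => hk ?_⟩
  rw [hj, itinerary, hstep k le_rfl, symbol_eq_some_iff.mpr hcon]

/-! ### The points of the orbits of the end points -/

/-- An orbit point may have been reached from the other side only. If both sides lie in the same
lap, their images coincide as points; otherwise `p` is itself a lateral end point of a lap and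
starts one of the orbits. -/
theorem mem_orbitPoints_step {p : ℝ × ℤˣ} (h : p.1 ∈ F.orbitPoints) :
    (F.step p).1 ∈ F.orbitPoints := by
  obtain ⟨q, k, hk⟩ := h
  rcases hs : F.symbol p with _ | j
  · rw [step_of_none hs]
    exact ⟨q, k, hk⟩
  by_cases hneg : F.InLap (p.1, -p.2) j
  · refine ⟨q, k + 1, ?_⟩
    have : F.symbol (F.step^[k] (F.lateral q)) = some j := by
      rw [symbol_eq_some_iff]
      rcases Int.units_eq_one_or ((F.step^[k] (F.lateral q)).2 * p.2) with h2 | h2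
      · have : F.step^[k] (F.lateral q) = p :=
          Prod.ext hk.symm ((mul_eq_one_iff_eq_inv.mp h2).trans (Int.units_inv_eq_self _))
        rw [this]
        exact symbol_eq_some_iff.mp hs
      · have : F.step^[k] (F.lateral q) = (p.1, -p.2) := by
          refine Prod.ext hk.symm ?_
          have h3 := congrArg (· * p.2) h2
          simpa [mul_assoc, Int.units_mul_self] using h3
        rwa [this]
    rw [Function.iterate_succ_apply', step_of_some hs, step_of_some this, hk]
  · refine ⟨(j, p.2), 1, ?_⟩
    rw [Function.iterate_one, ← (symbol_eq_some_iff.mp hs).eq_lateral hneg]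

variable (F)

theorem left_mem_orbitPoints (j : Fin n) : F.left j ∈ F.orbitPoints := ⟨(j, 1), 0, by simp [lateral]⟩

theorem right_mem_orbitPoints (j : Fin n) : F.right j ∈ F.orbitPoints :=
  ⟨(j, -1), 0, by simp [lateral, show (-1 : ℤˣ) ≠ 1 by decide]⟩

theorem a_mem_orbitPoints (k : Fin (n + 2)) : F.a k ∈ F.orbitPoints := by
  have hleft : ∀ k : Fin (n + 1), k ≠ F.hole → F.a k.castSucc ∈ F.orbitPoints := by
    intro k hk
    obtain ⟨j, rfl⟩ := Fin.exists_succAbove_eq hk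
    exact F.left_mem_orbitPoints j
  have hright : ∀ k : Fin (n + 1), k ≠ F.hole → F.a k.succ ∈ F.orbitPoints := by
    intro k hk
    obtain ⟨j, rfl⟩ := Fin.exists_succAbove_eq hk
    exact F.right_mem_orbitPoints j
  rcases Fin.eq_zero_or_eq_succ k with rfl | ⟨l, rfl⟩
  · exact hleft 0 F.hole_pos.ne
  · by_cases hl : l = F.hole
    · have hlt : (l : ℕ) < n := by
        have := Fin.lt_def.mp F.hole_lt_last
        rw [hl]; simpa using this
      have : l.succ = (⟨l + 1, by omega⟩ : Fin (n + 1)).castSucc := rfl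
      rw [this]
      refine hleft _ fun h => ?_
      have := congrArg Fin.val (h.trans hl.symm)
      simp at this
    · exact hright l hl

theorem orbitPoints_subset : F.orbitPoints ⊆ Set.Icc (F.a 0) (F.a (Fin.last (n + 1))) := by
  rintro x ⟨q, k, rfl⟩
  exact ((F.inLap_lateral q).inside.iterate_step k).mem_Icc

theorem orbitPoints_finite (hF : ∀ q : Fin n × ℤˣ,
    F.EventuallyPeriodic (F.lateral q) ∨ F.FallsIntoHole (F.lateral q)) :
    F.orbitPoints.Finite := by
  have hper : ∀ q, F.EventuallyPeriodic (F.lateral q) := by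
    intro q
    rcases hF q with h | ⟨k, hk⟩
    · exact h
    · exact ⟨k, 1, one_pos, by
        rw [Function.iterate_succ_apply', step_of_none (F := F) hk]⟩
  have hfin : ∀ q, (Set.range fun k => (F.step^[k] (F.lateral q)).1).Finite := by
    intro q
    obtain ⟨r, c, hc, hrc⟩ := hper q
    refine ((Set.finite_Iio (r + c)).image fun k => (F.step^[k] (F.lateral q)).1).subset ?_
    rintro _ ⟨k, rfl⟩
    induction k using Nat.strong_induction_on with
    | _ k ih =>
      rcases lt_or_ge k (r + c) with hk | hk
      · exact ⟨k, hk, rfl⟩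
      · obtain ⟨d, rfl⟩ := Nat.exists_eq_add_of_le' hk
        have := ih (d + r) (by omega)
        simp only [Function.iterate_add_apply F.step d] at this ⊢
        rwa [hrc]
  refine (Set.finite_iUnion hfin).subset ?_
  rintro x ⟨q, k, rfl⟩
  exact Set.mem_iUnion.mpr ⟨q, k, rfl⟩

theorem exists_isMarkovPartition (hF : ∀ q : Fin n × ℤˣ,
    F.EventuallyPeriodic (F.lateral q) ∨ F.FallsIntoHole (F.lateral q)) :
    ∃ (m : ℕ) (b : Fin (m + 1) → ℝ), F.IsMarkovPartition b := by
  set s := (F.orbitPoints_finite hF).toFinset with hs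
  have hne : s.card ≠ 0 := by
    rw [Finset.card_ne_zero]
    exact ⟨F.a 0, by simpa [hs] using F.a_mem_orbitPoints 0⟩
  obtain ⟨m, hm⟩ := Nat.exists_eq_succ_of_ne_zero hne
  exact ⟨m, s.orderEmbOfFin hm, (s.orderEmbOfFin hm).strictMono, by simp [hs]⟩

end

end HoleMap

namespace HoleMap

noncomputable section

variable {n : ℕ} (F : HoleMap n)

/-! ### The invariant coordinates -/

open Classical in
/-- The coefficient of the invariant coordinate of `p` at a symbol, which may be that of the
hole. -/
def thetaSymbol (β : ℝ) (p : ℝ × ℤˣ) (o : Option (Fin n)) : ℝ⟦X⟧ :=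
  PowerSeries.mk fun k => if F.itinerary p k = o then F.tau β p k else 0

theorem thetaSymbol_some (β : ℝ) (p : ℝ × ℤˣ) (j : Fin n) :
    F.thetaSymbol β p (some j) = F.theta β p j := rfl

variable {F}

theorem thetaSymbol_congr {p p' : ℝ × ℤˣ} (h : F.itinerary p = F.itinerary p') (β : ℝ) :
    F.thetaSymbol β p = F.thetaSymbol β p' := by
  funext o
  simp only [thetaSymbol, tau, h]

variable (F)

theorem tau_succ (β : ℝ) (p : ℝ × ℤˣ) (k : ℕ) :
    F.tau β p (k + 1) = F.weight β (F.symbol p) * F.tau β (F.step p) k := by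
  rw [tau, Finset.prod_range_succ', mul_comm]
  rfl

/-- Splitting off the first symbol gives θ_x = S_0 + κ t θ_{F(x)}. It persists in the hole because
the weight there is 0. This is the source of Θ(1 - K) = indicators. -/
theorem thetaSymbol_eq (β : ℝ) (p : ℝ × ℤˣ) (o : Option (Fin n)) :
    F.thetaSymbol β p o = (if F.symbol p = o then 1 else 0) +
      PowerSeries.C (F.weight β (F.symbol p)) * PowerSeries.X *
        F.thetaSymbol β (F.step p) o := by
  ext k
  rw [mul_assoc, map_add, PowerSeries.coeff_C_mul]
  cases k with
  | zero =>
    rw [PowerSeries.coeff_zero_X_mul]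
    simp only [thetaSymbol, PowerSeries.coeff_mk, itinerary_zero, mul_zero, add_zero]
    by_cases h : F.symbol p = o <;> simp [tau, h]
  | succ k =>
    rw [PowerSeries.coeff_succ_X_mul]
    have h0 : PowerSeries.coeff (k + 1) (if F.symbol p = o then (1 : ℝ⟦X⟧) else 0) = 0 := by
      split_ifs <;> simp [PowerSeries.coeff_one]
    simp only [thetaSymbol, PowerSeries.coeff_mk, itinerary_succ, tau_succ, h0, zero_add, mul_ite,
      mul_zero]

/-- The sum telescopes: the θ_o add up to the series of the τ_k t^k, and the weighted terms to the
same series without τ_0 = 1. -/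
theorem sum_thetaSymbol (β : ℝ) (p : ℝ × ℤˣ) :
    ∑ o, (1 - PowerSeries.C (F.weight β o) * PowerSeries.X) * F.thetaSymbol β p o = 1 := by
  have h1 : ∀ k, ∑ o, PowerSeries.coeff k (F.thetaSymbol β p o) = F.tau β p k := by
    intro k
    simp [thetaSymbol, PowerSeries.coeff_mk]
  ext k
  simp only [sub_mul, one_mul, Finset.sum_sub_distrib, map_sub, map_sum, h1, mul_assoc,
    PowerSeries.coeff_C_mul]
  cases k with
  | zero => simp [tau]
  | succ k =>
    simp only [PowerSeries.coeff_succ_X_mul, PowerSeries.coeff_one, Nat.succ_ne_zero, if_false]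
    rw [sub_eq_zero]
    have : ∀ o, F.weight β o * PowerSeries.coeff k (F.thetaSymbol β p o) =
        if F.itinerary p k = o then F.tau β p (k + 1) else 0 := by
      intro o
      simp only [thetaSymbol, PowerSeries.coeff_mk]
      split_ifs with h
      · rw [tau, tau, Finset.prod_range_succ, h, mul_comm]
      · rw [mul_zero]
    simp [this]

/-! ### The lateral end points of the Markov intervals -/

/-- The lateral end points of the Markov intervals: `inl i` is the left one of the interval `i`
and `inr i` the right one. -/
def pieceEnd {m : ℕ} (b : Fin (m + 1) → ℝ) : Fin m ⊕ Fin m → ℝ × ℤˣ :=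
  Sum.elim (fun i => (b i.castSucc, 1)) fun i => (b i.succ, -1)

variable {F} {m : ℕ} {b : Fin (m + 1) → ℝ}

theorem pieceEnd_injective (hb : StrictMono b) : Function.Injective (pieceEnd b) := by
  have h1 : (1 : ℤˣ) ≠ -1 := by decide
  rintro (i | i) (j | j) h <;> have h2 := congrArg Prod.snd h <;> have h3 := congrArg Prod.fst h
  · exact congrArg Sum.inl (Fin.castSucc_injective _ (hb.injective h3))
  · exact absurd h2 h1
  · exact absurd h2 h1.symm
  · exact congrArg Sum.inr (Fin.succ_injective _ (hb.injective h3))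

namespace IsMarkovPartition

variable (hb : F.IsMarkovPartition b)
include hb

theorem mem_orbitPoints (i : Fin (m + 1)) : b i ∈ F.orbitPoints := hb.2 ▸ Set.mem_range_self i

theorem pieceEnd_mem_orbitPoints (x : Fin m ⊕ Fin m) : (pieceEnd b x).1 ∈ F.orbitPoints := by
  rcases x with i | i
  exacts [hb.mem_orbitPoints _, hb.mem_orbitPoints _]

theorem inside_pieceEnd (x : Fin m ⊕ Fin m) : F.Inside (pieceEnd b x) := by
  have h := fun i => F.orbitPoints_subset (hb.mem_orbitPoints i)
  rcases x with i | i
  · exact Or.inl ⟨rfl, (h _).1, (hb.1 Fin.castSucc_lt_succ).trans_le (h i.succ).2⟩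
  · exact Or.inr ⟨rfl, (h i.castSucc).1.trans_lt (hb.1 Fin.castSucc_lt_succ), (h _).2⟩

theorem exists_pieceEnd_eq {p : ℝ × ℤˣ} (hp : F.Inside p) (hp' : p.1 ∈ F.orbitPoints) :
    ∃ x, pieceEnd b x = p := by
  rw [← hb.2] at hp'
  obtain ⟨i, hi⟩ := hp'
  rcases hp with ⟨h1, h2, h3⟩ | ⟨h1, h2, h3⟩
  · obtain ⟨l, hl⟩ := hb.2.symm ▸ F.a_mem_orbitPoints (Fin.last (n + 1))
    rw [← hi, ← hl, hb.1.lt_iff_lt] at h3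
    obtain ⟨j, rfl⟩ := Fin.exists_castSucc_eq.mpr (h3.trans_le (Fin.le_last l)).ne
    exact ⟨Sum.inl j, Prod.ext hi h1.symm⟩
  · obtain ⟨l, hl⟩ := hb.2.symm ▸ F.a_mem_orbitPoints 0
    rw [← hi, ← hl, hb.1.lt_iff_lt] at h2
    obtain ⟨j, rfl⟩ := Fin.exists_succ_eq.mpr ((Fin.zero_le l).trans_lt h2).ne'
    exact ⟨Sum.inr j, Prod.ext hi h1.symm⟩

theorem exists_next (x : Fin m ⊕ Fin m) :
    ∃ y, pieceEnd b y = F.representative (F.step (pieceEnd b x)) :=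
  hb.exists_pieceEnd_eq (hb.inside_pieceEnd x).step.representative (by
    rw [representative_fst]
    exact mem_orbitPoints_step (hb.pieceEnd_mem_orbitPoints x))

/-- The map on the lateral end points of the Markov intervals, up to replacing a lateral point by
the representative of its itinerary. -/
def next (x : Fin m ⊕ Fin m) : Fin m ⊕ Fin m := (hb.exists_next x).choose

theorem pieceEnd_next (x : Fin m ⊕ Fin m) :
    pieceEnd b (hb.next x) = F.representative (F.step (pieceEnd b x)) :=
  (hb.exists_next x).choose_spec

theorem itinerary_next (x : Fin m ⊕ Fin m) (k : ℕ) :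
    F.itinerary (pieceEnd b (hb.next x)) k = F.itinerary (pieceEnd b x) (k + 1) := by
  rw [pieceEnd_next, itinerary_representative, itinerary_succ]

theorem itinerary_iterate_next (x : Fin m ⊕ Fin m) (l k : ℕ) :
    F.itinerary (pieceEnd b (hb.next^[l] x)) k = F.itinerary (pieceEnd b x) (l + k) := by
  induction l generalizing x with
  | zero => rw [zero_add]; rfl
  | succ l ih => rw [Function.iterate_succ_apply, ih, itinerary_next]; congr 1; omega

/-- Among the periodic points of `next`, the itinerary determines the point. -/
theorem eq_of_itinerary_eq {x y : Fin m ⊕ Fin m} (hx : x ∈ Function.periodicPts hb.next)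
    (hy : y ∈ Function.periodicPts hb.next)
    (h : F.itinerary (pieceEnd b x) = F.itinerary (pieceEnd b y))
    (hne : ∀ k, F.itinerary (pieceEnd b x) k ≠ none) : x = y := by
  -- A periodic point is a value of `next`, hence already a representative.
  have hrep : ∀ z ∈ Function.periodicPts hb.next,
      F.representative (pieceEnd b z) = pieceEnd b z := by
    rintro z ⟨k, hk, hz⟩
    obtain ⟨l, rfl⟩ := Nat.exists_eq_succ_of_ne_zero hk.ne'
    rw [Function.IsPeriodicPt, Function.IsFixedPt, Function.iterate_succ_apply'] at hz
    rw [← hz, pieceEnd_next, representative_representative]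
  apply pieceEnd_injective hb.1
  have hpos := HoleMap.eq_of_itinerary_eq h hne
  by_cases hs : F.SidesAgree (pieceEnd b x).1
  · rw [← hrep x hx, ← hrep y hy, representative, representative, ← hpos, if_pos hs, if_pos hs]
  · refine Prod.ext hpos ?_
    by_contra hcon
    refine hs ?_
    generalize pieceEnd b x = p at *
    generalize pieceEnd b y = p' at *
    obtain ⟨u, s⟩ := p
    obtain ⟨v, t⟩ := p'
    obtain rfl : u = v := hpos
    rcases Int.units_eq_one_or s with rfl | rfl <;> rcases Int.units_eq_one_or t with rfl | rfl
    · exact absurd rfl hcon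
    · exact h
    · exact h.symm
    · exact absurd rfl hcon

/-- The matrix of the weighted action on the lateral end points of the Markov intervals. -/
def lateralMatrix (β : ℝ) : Matrix (Fin m ⊕ Fin m) (Fin m ⊕ Fin m) ℝ⟦X⟧ :=
  Matrix.ofWeightedMap hb.next fun x =>
    PowerSeries.C (F.weight β (F.symbol (pieceEnd b x))) * PowerSeries.X

end IsMarkovPartition

/-! ### Cycles of the lateral action and R(t) -/

theorem nonempty_fin (F : HoleMap n) : Nonempty (Fin n) :=
  let ⟨j, _⟩ := Fin.exists_succAbove_eq F.hole_pos.ne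
  ⟨j⟩

/-- The cycles in which the orbits of the lateral end points of the laps end are the cycles of
words of the periodic points of `next` that avoid the hole. -/
theorem IsMarkovPartition.mem_cycles_iff (hb : F.IsMarkovPartition b)
    {word : Fin m ⊕ Fin m → ℕ → Fin n}
    (hword : ∀ x, (∀ k, F.itinerary (pieceEnd b x) k ≠ none) →
      ∀ k, F.itinerary (pieceEnd b x) k = some (word x k)) (c : Cycle (ℕ → Fin n)) :
    c ∈ F.cycles ↔ ∃ x ∈ Function.periodicPts hb.next,
      (∀ k, F.itinerary (pieceEnd b x) k ≠ none) ∧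
        c = Function.periodicOrbit shift (word x) := by
  constructor
  · intro hc
    obtain ⟨q, w, ⟨hw, r, hr⟩, rfl⟩ := Set.mem_iUnion.mp hc
    obtain ⟨x, hx⟩ := hb.exists_pieceEnd_eq (F.inLap_lateral q).inside ⟨q, 0, rfl⟩
    -- `next` acts on a finite set, so the orbit repeats after time `r`; a point on the loop reads a
    -- shift of `w`.
    obtain ⟨i, j, hij, heq⟩ := Finite.exists_ne_map_eq_of_infinite fun k => hb.next^[r + k] x
    wlog hlt : i < j generalizing i j
    · exact this j i hij.symm heq.symm (lt_of_le_of_ne (not_lt.mp hlt) hij.symm)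
    have hit : ∀ k, F.itinerary (pieceEnd b (hb.next^[r + i] x)) k = some (w (k + i)) := by
      intro k
      rw [hb.itinerary_iterate_next, hx, add_assoc, hr, add_comm]
    have hne : ∀ k, F.itinerary (pieceEnd b (hb.next^[r + i] x)) k ≠ none := fun k => by
      rw [hit]; exact Option.some_ne_none _
    refine ⟨hb.next^[r + i] x, ⟨j - i, by omega, ?_⟩, hne, ?_⟩
    · rw [Function.IsPeriodicPt, Function.IsFixedPt, ← Function.iterate_add_apply]
      rw [show j - i + (r + i) = r + j by omega]
      exact heq.symm
    · have : word (hb.next^[r + i] x) = shift^[i] w := by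
        funext k
        rw [shift_iterate]
        exact Option.some.inj ((hword _ hne k).symm.trans (hit k))
      rw [this, Function.periodicOrbit_apply_iterate_eq hw]
  · rintro ⟨x, ⟨l, hl, hper⟩, hne, rfl⟩
    have hw : word x ∈ Function.periodicPts shift := by
      refine ⟨l, hl, funext fun k => ?_⟩
      rw [shift_iterate]
      apply Option.some.inj
      rw [← hword x hne, ← hword x hne, add_comm, ← hb.itinerary_iterate_next, hper]
    -- If the sides agree, the orbit that passes through the point has the right itinerary from
    -- whichever side it arrives. Otherwise the orbit of this side meets a lateral end point, from
    -- which the cycle is reached.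
    by_cases hs : F.SidesAgree (pieceEnd b x).1
    · obtain ⟨q, k, hk⟩ := hb.pieceEnd_mem_orbitPoints x
      refine Set.mem_iUnion.mpr ⟨q, word x, ⟨hw, k, fun i => ?_⟩, rfl⟩
      have h1 : F.representative (F.step^[k] (F.lateral q)) = F.representative (pieceEnd b x) := by
        rw [representative, representative, ← hk, if_pos hs, if_pos hs]
      rw [itinerary_add, ← itinerary_representative, h1, itinerary_representative, hword x hne]
    · obtain ⟨k, q, hk⟩ := exists_iterate_eq_lateral hs hne
      refine Set.mem_iUnion.mpr ⟨q, shift^[k] (word x), ⟨?_, 0, fun i => ?_⟩,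
        Function.periodicOrbit_apply_iterate_eq hw k⟩
      · obtain ⟨d, hd, hd'⟩ := hw
        exact ⟨d, hd, hd'.apply_iterate k⟩
      · rw [← hk, zero_add, ← itinerary_add, hword x hne, shift_iterate, add_comm]

/-- `det (1 - K)` for the weighted action `K` on the lateral end points is `R(t)`. -/
theorem IsMarkovPartition.det_one_sub_lateralMatrix (hb : F.IsMarkovPartition b) (β : ℝ) :
    (1 - hb.lateralMatrix β).det = (F.cyclotomicProduct β : ℝ⟦X⟧) := by
  classical
  have : Nonempty (Fin n) := F.nonempty_fin
  obtain ⟨word, hword⟩ : ∃ word : Fin m ⊕ Fin m → ℕ → Fin n,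
      ∀ x, (∀ k, F.itinerary (pieceEnd b x) k ≠ none) →
        ∀ k, F.itinerary (pieceEnd b x) k = some (word x k) := by
    refine ⟨fun x k => (F.itinerary (pieceEnd b x) k).getD (Classical.arbitrary _),
      fun x hx k => ?_⟩
    obtain ⟨j, hj⟩ := Option.ne_none_iff_exists'.mp (hx k)
    simp [hj]
  have hnext : ∀ x, (∀ k, F.itinerary (pieceEnd b x) k ≠ none) →
      ∀ l k, F.itinerary (pieceEnd b (hb.next^[l] x)) k ≠ none := fun x hx l k => by
    rw [hb.itinerary_iterate_next]; exact hx _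
  have hword_next : ∀ x, (∀ k, F.itinerary (pieceEnd b x) k ≠ none) →
      ∀ l, word (hb.next^[l] x) = shift^[l] (word x) := by
    intro x hx l
    funext k
    rw [shift_iterate]
    apply Option.some.inj
    rw [← hword _ (hnext x hx l), ← hword x hx, hb.itinerary_iterate_next, add_comm]
  have hinj : ∀ x y, x ∈ Function.periodicPts hb.next → y ∈ Function.periodicPts hb.next →
      (∀ k, F.itinerary (pieceEnd b x) k ≠ none) → (∀ k, F.itinerary (pieceEnd b y) k ≠ none) →
      word x = word y → x = y := by
    intro x y hx hy hx' hy' h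
    exact hb.eq_of_itinerary_eq hx hy (funext fun k => by rw [hword x hx', hword y hy', h]) hx'
  -- Equal minimal periods ensure that passing to words preserves the length of a cycle, and so the
  -- exponent of t.
  have hperiod : ∀ x ∈ Function.periodicPts hb.next,
      (∀ k, F.itinerary (pieceEnd b x) k ≠ none) → ∀ l,
      Function.IsPeriodicPt shift l (word x) ↔ Function.IsPeriodicPt hb.next l x := by
    rintro x hx hx' l
    rw [Function.IsPeriodicPt, Function.IsFixedPt, ← hword_next x hx']
    refine ⟨fun h => hinj _ _ ?_ hx (hnext x hx' l) hx' h, fun h => by rw [h]⟩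
    obtain ⟨d, hd, hd'⟩ := hx
    exact ⟨d, hd, hd'.apply_iterate l⟩
  have hmap : ∀ x ∈ Function.periodicPts hb.next,
      (∀ k, F.itinerary (pieceEnd b x) k ≠ none) →
      (Function.periodicOrbit hb.next x).map word = Function.periodicOrbit shift (word x) := by
    intro x hx hx'
    rw [Function.periodicOrbit_def, Function.periodicOrbit_def,
      Function.minimalPeriod_eq_minimalPeriod_iff.mpr (hperiod x hx hx'), Cycle.map_coe,
      List.map_map]
    congr 2
    funext k
    exact hword_next x hx' k
  have hprod : (F.cyclotomicProduct β : ℝ⟦X⟧) =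
      ∏ c ∈ F.cycles_finite.toFinset, (F.cyclotomic β c : ℝ⟦X⟧) :=
    map_prod (Polynomial.coeToPowerSeries.ringHom (R := ℝ)) _ _
  rw [lateralMatrix, Matrix.det_one_sub_ofWeightedMap, hprod]
  -- Cycles of `next` through the hole have weight 0 and give the factor 1, so they can be left out.
  rw [← Finset.prod_subset (s₁ := (Finset.univ.filter fun x => x ∈ Function.periodicPts hb.next ∧
    ∀ k, F.itinerary (pieceEnd b x) k ≠ none).image (Function.periodicOrbit hb.next))]
  · refine Finset.prod_nbij (Cycle.map word) ?_ ?_ ?_ ?_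
    · intro c hc
      simp only [Finset.mem_image, Finset.mem_filter, Finset.mem_univ, true_and] at hc
      obtain ⟨x, ⟨hx, hx'⟩, rfl⟩ := hc
      rw [Set.Finite.mem_toFinset, hb.mem_cycles_iff hword]
      exact ⟨x, hx, hx', hmap x hx hx'⟩
    · intro c hc c' hc' h
      simp only [Finset.coe_image, Finset.coe_filter, Finset.mem_univ, true_and, Set.mem_image,
        Set.mem_ofPred_eq] at hc hc'
      obtain ⟨x, ⟨hx, hx'⟩, rfl⟩ := hc
      obtain ⟨y, ⟨hy, hy'⟩, rfl⟩ := hc'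
      rw [hmap x hx hx', hmap y hy hy'] at h
      have hwp : ∀ z ∈ Function.periodicPts hb.next,
          (∀ k, F.itinerary (pieceEnd b z) k ≠ none) →
          word z ∈ Function.periodicPts shift := by
        rintro z hz hz'
        obtain ⟨d, hd, hd'⟩ := id hz
        exact ⟨d, hd, (hperiod z hz hz' d).mpr hd'⟩
      have h1 := Function.self_mem_periodicOrbit (hwp x hx hx')
      rw [h, Function.mem_periodicOrbit_iff (hwp y hy hy')] at h1
      obtain ⟨l, hl⟩ := h1
      rw [← hword_next y hy'] at hl
      have hyl : hb.next^[l] y ∈ Function.periodicPts hb.next := by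
        obtain ⟨d, hd, hd'⟩ := hy
        exact ⟨d, hd, hd'.apply_iterate l⟩
      rw [← hinj _ _ hyl hx (hnext y hy' l) hx' hl, Function.periodicOrbit_apply_iterate_eq hy]
    · intro c hc
      rw [Set.Finite.coe_toFinset, hb.mem_cycles_iff hword] at hc
      obtain ⟨x, hx, hx', rfl⟩ := hc
      exact ⟨Function.periodicOrbit hb.next x, Finset.mem_coe.mpr
        (Finset.mem_image.mpr ⟨x, Finset.mem_filter.mpr ⟨Finset.mem_univ x, hx, hx'⟩, rfl⟩),
        hmap x hx hx'⟩
    · intro c hc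
      simp only [Finset.mem_image, Finset.mem_filter, Finset.mem_univ, true_and] at hc
      obtain ⟨x, ⟨hx, hx'⟩, rfl⟩ := hc
      have hmem : ∀ y ∈ (Function.periodicOrbit hb.next x).toMultiset,
          F.weight β (F.symbol (pieceEnd b y)) = F.weight β (some (word y 0)) := by
        intro y hy
        have hy1 : y ∈ Function.periodicOrbit hb.next x := by
          revert hy
          generalize Function.periodicOrbit hb.next x = c
          exact Quot.inductionOn c fun l => id
        obtain ⟨l, rfl⟩ := (Function.mem_periodicOrbit_iff hx).mp hy1
        rw [← itinerary_zero, hword _ (hnext x hx' l)]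
      generalize Function.periodicOrbit hb.next x = c at hmem
      have h1 : (c.map word).toMultiset = c.toMultiset.map word :=
        Quot.inductionOn c fun l => rfl
      have h2 : (c.map word).length = c.toMultiset.card := Quot.inductionOn c fun l => by
        simp
      rw [cyclotomic, h1, h2, Multiset.prod_map_mul, Multiset.map_const', Multiset.prod_replicate,
        Multiset.map_map]
      push_cast
      rw [map_multiset_prod, Multiset.map_map]
      congr 3
      refine Multiset.map_congr rfl fun y hy => ?_
      simp only [Function.comp_apply, hmem y hy]
  · refine Finset.image_subset_image fun x hx => ?_
    simp only [Finset.mem_filter, Finset.mem_univ, true_and] at hx ⊢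
    exact hx.1
  · intro c hc hc'
    simp only [Finset.mem_image, Finset.mem_filter, Finset.mem_univ, true_and] at hc hc'
    obtain ⟨x, hx, rfl⟩ := hc
    have hx' : ¬∀ k, F.itinerary (pieceEnd b x) k ≠ none := fun h => hc' ⟨x, ⟨hx, h⟩, rfl⟩
    push Not at hx'
    obtain ⟨k, hk⟩ := hx'
    rw [sub_eq_self]
    refine Multiset.prod_eq_zero (Multiset.mem_map.mpr ⟨hb.next^[k] x, ?_, ?_⟩)
    · have h1 := Function.iterate_mem_periodicOrbit hx k
      revert h1
      generalize Function.periodicOrbit hb.next x = c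
      exact Quot.inductionOn c fun l => id
    · rw [← add_zero k, ← hb.itinerary_iterate_next, itinerary_zero] at hk
      rw [hk]
      simp [weight]

/-- Every cycle has positive length, so each factor has constant term 1. -/
theorem isUnit_cyclotomicProduct (β : ℝ) : IsUnit (F.cyclotomicProduct β : ℝ⟦X⟧) := by
  have hprod : (F.cyclotomicProduct β : ℝ⟦X⟧) =
      ∏ c ∈ F.cycles_finite.toFinset, (F.cyclotomic β c : ℝ⟦X⟧) :=
    map_prod (Polynomial.coeToPowerSeries.ringHom (R := ℝ)) _ _
  rw [PowerSeries.isUnit_iff_constantCoeff, hprod, map_prod]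
  rw [Finset.prod_eq_one]
  · exact isUnit_one
  · intro c hc
    rw [Set.Finite.mem_toFinset] at hc
    obtain ⟨q, w, ⟨hw, -⟩, rfl⟩ := Set.mem_iUnion.mp hc
    have := Function.minimalPeriod_pos_of_mem_periodicPts hw
    simp [cyclotomic, Function.periodicOrbit_length, this.ne']

end

end HoleMap

/-! ### A basis adapted to a partition of an interval -/

section PartitionBasis

open Matrix

variable {R : Type*} [CommRing R] {m : ℕ}

/-- The columns are the boundaries of the `m` intervals of a partition, `inr i - inl i`, and the
differences `inl i - inr (i - 1)` between the sides of its points, the first one being `inl 0`. -/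
def partitionBasis (R : Type*) [CommRing R] (m : ℕ) : Matrix (Fin m ⊕ Fin m) (Fin m ⊕ Fin m) R :=
  fromBlocks (-1) 1 1 (of fun l i => if (l : ℕ) + 1 = i then -1 else 0)

/-- The coordinates with respect to `partitionBasis`. -/
def partitionCoord (R : Type*) [CommRing R] (m : ℕ) : Matrix (Fin m ⊕ Fin m) (Fin m ⊕ Fin m) R :=
  fromBlocks (of fun i k => if i < k then 1 else 0) (of fun i k => if i ≤ k then 1 else 0)
    (of fun i k => if i ≤ k then 1 else 0) (of fun i k => if i ≤ k then 1 else 0)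

variable {Y : Type*} (M : Matrix Y (Fin m ⊕ Fin m) R)

theorem mul_partitionBasis_inl (y : Y) (i : Fin m) :
    (M * partitionBasis R m) y (Sum.inl i) = M y (Sum.inr i) - M y (Sum.inl i) := by
  simp [mul_apply, partitionBasis, one_apply]
  ring

theorem mul_partitionBasis_inr_zero (y : Y) {i : Fin m} (hi : (i : ℕ) = 0) :
    (M * partitionBasis R m) y (Sum.inr i) = M y (Sum.inl i) := by
  simp [mul_apply, partitionBasis, one_apply, hi]

theorem mul_partitionBasis_inr_succ (y : Y) {l i : Fin m} (hi : (l : ℕ) + 1 = i) :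
    (M * partitionBasis R m) y (Sum.inr i) = M y (Sum.inl i) - M y (Sum.inr l) := by
  have : ∀ k : Fin m, ((k : ℕ) + 1 = i) = (k = l) := fun k => by
    rw [Fin.ext_iff, ← hi]; simp
  simp [mul_apply, partitionBasis, one_apply, this, sub_eq_add_neg]

/-- In the order `inl 0`, `inr 0`, `inl 1`, `inr 1`, … the basis consists of the successive
differences, so a lateral point is the sum of all the differences up to it. -/
theorem partitionCoord_mul_partitionBasis : partitionCoord R m * partitionBasis R m = 1 := by
  ext x y
  have hcase : ∀ k : Fin m, (k : ℕ) = 0 ∨ ∃ l : Fin m, (l : ℕ) + 1 = k := fun k => by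
    rcases Nat.eq_zero_or_pos (k : ℕ) with h | h
    · exact Or.inl h
    · exact Or.inr ⟨⟨k - 1, by omega⟩, by simp only; omega⟩
  rcases y with k | k
  · rw [mul_partitionBasis_inl]
    rcases x with i | i
    · simp only [partitionCoord, fromBlocks_apply₁₁, fromBlocks_apply₁₂, of_apply, one_apply,
        Sum.inl.injEq, Fin.le_def, Fin.lt_def, Fin.ext_iff]
      split_ifs <;> first | omega | simp
    · simp [partitionCoord, one_apply]
  · rcases hcase k with hk | ⟨l, hl⟩
    · rw [mul_partitionBasis_inr_zero _ _ hk]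
      rcases x with i | i
      · simp only [partitionCoord, fromBlocks_apply₁₁, of_apply, one_apply, Fin.lt_def,
          reduceCtorEq, if_false]
        split_ifs <;> first | omega | simp
      · simp only [partitionCoord, fromBlocks_apply₂₁, of_apply, one_apply, Fin.le_def,
          Sum.inr.injEq, Fin.ext_iff]
        split_ifs <;> first | omega | simp
    · rw [mul_partitionBasis_inr_succ _ _ hl]
      rcases x with i | i
      · simp only [partitionCoord, fromBlocks_apply₁₁, fromBlocks_apply₁₂, of_apply, one_apply,
          Fin.lt_def, Fin.le_def, reduceCtorEq, if_false]
        split_ifs <;> first | omega | simp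
      · simp only [partitionCoord, fromBlocks_apply₂₁, fromBlocks_apply₂₂, of_apply, one_apply,
          Fin.le_def, Sum.inr.injEq, Fin.ext_iff]
        split_ifs <;> first | omega | simp

/-- The matrix that selects the columns `e k`. -/
def columnSelection (R : Type*) [CommRing R] {A X : Type*} [DecidableEq X] (e : A → X) :
    Matrix A X R := of fun k x => if x = e k then 1 else 0

theorem mul_columnSelection_transpose_apply {A X : Type*} [Fintype X] [DecidableEq X] (e : A → X)
    (M : Matrix Y X R) (y : Y) (k : A) :
    (M * (columnSelection R e)ᵀ) y k = M y (e k) := by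
  simp [mul_apply, columnSelection]

open Classical in
theorem mul_columnSelection_apply {A X : Type*} [Fintype A] [Fintype X] [DecidableEq X] {e : A → X}
    (he : Function.Injective e) (M : Matrix Y X R) (y : Y) (x : X) :
    (M * (columnSelection R e)ᵀ * columnSelection R e) y x =
      if x ∈ Set.range e then M y x else 0 := by
  rw [mul_apply]
  simp only [mul_columnSelection_transpose_apply]
  split_ifs with h
  · obtain ⟨k, rfl⟩ := h
    simp [columnSelection, he.eq_iff]
  · refine Finset.sum_eq_zero fun k _ => ?_
    have : x ≠ e k := fun hx => h ⟨k, hx.symm⟩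
    simp [columnSelection, this]

end PartitionBasis

namespace HoleMap

noncomputable section

variable {n : ℕ} {F : HoleMap n} {m : ℕ} {b : Fin (m + 1) → ℝ}

/-! ### The weighted transition matrix -/

variable (F) in
theorem image_branch_Ioo_of_pos {k : Fin n} (hk : 0 < F.slope k) (x y : ℝ) :
    F.branch k '' Set.Ioo x y = Set.Ioo (F.branch k x) (F.branch k y) :=
  Set.image_affine_Ioo hk (F.intercept k) x y

variable (F) in
theorem image_branch_Ioo_of_neg {k : Fin n} (hk : F.slope k < 0) (x y : ℝ) :
    F.branch k '' Set.Ioo x y = Set.Ioo (F.branch k y) (F.branch k x) := by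
  have hcomp : F.branch k = (fun z => -F.slope k * z + F.intercept k) ∘ fun z => -z := by
    funext z
    simp [branch]
  rw [hcomp, Set.image_comp, Set.image_neg_eq_neg, Set.neg_Ioo,
    Set.image_affine_Ioo (neg_pos.mpr hk)]
  simp

namespace IsMarkovPartition

variable (hb : F.IsMarkovPartition b)
include hb

theorem exists_left (k : Fin n) : ∃ u, b u = F.left k := by
  have := F.left_mem_orbitPoints k
  rwa [← hb.2] at this

theorem exists_right (k : Fin n) : ∃ u, b u = F.right k := by
  have := F.right_mem_orbitPoints k
  rwa [← hb.2] at this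

/-- The ends of the laps are Markov points, so no lap ends inside a Markov interval. -/
theorem symbol_pieceEnd_inl (j : Fin m) :
    F.symbol (pieceEnd b (Sum.inl j)) = F.symbol (pieceEnd b (Sum.inr j)) := by
  have h1 : (1 : ℤˣ) ≠ -1 := by decide
  have h : ∀ k, F.InLap (pieceEnd b (Sum.inl j)) k ↔ F.InLap (pieceEnd b (Sum.inr j)) k := by
    intro k
    obtain ⟨u, hu⟩ := hb.exists_left k
    obtain ⟨v, hv⟩ := hb.exists_right k
    simp only [InLap, pieceEnd, Sum.elim_inl, Sum.elim_inr, true_and, h1, h1.symm, false_and,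
      or_false, false_or, ← hu, ← hv, hb.1.le_iff_le, hb.1.lt_iff_lt, Fin.le_castSucc_iff,
      Fin.castSucc_lt_iff_succ_le]
  rcases hs : F.symbol (pieceEnd b (Sum.inr j)) with _ | k
  · rw [symbol_eq_none_iff] at hs ⊢
    exact fun k hk => hs k ((h k).mp hk)
  · rw [symbol_eq_some_iff] at hs ⊢
    exact (h k).mpr hs

theorem inLap_of_mem_openPiece {j : Fin m} {k : Fin n} {x : ℝ} (hx : x ∈ openPiece b j)
    (hk : x ∈ Set.Icc (F.left k) (F.right k)) : F.InLap (pieceEnd b (Sum.inl j)) k := by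
  obtain ⟨u, hu⟩ := hb.exists_left k
  refine Or.inl ⟨rfl, ?_, hx.1.trans_le hk.2⟩
  have h : b u < b j.succ := by rw [hu]; exact hk.1.trans_lt hx.2
  rw [hb.1.lt_iff_lt, ← Fin.le_castSucc_iff, ← hb.1.le_iff_le, hu] at h
  exact h

theorem openPiece_nonempty (j : Fin m) : (openPiece b j).Nonempty :=
  Set.nonempty_Ioo.mpr (hb.1 Fin.castSucc_lt_succ)

theorem openPiece_subset {j : Fin m} {k : Fin n}
    (hk : F.symbol (pieceEnd b (Sum.inl j)) = some k) :
    openPiece b j ⊆ Set.Icc (F.left k) (F.right k) := by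
  have h1 := (symbol_eq_some_iff.mp hk).mem_Icc
  rw [hb.symbol_pieceEnd_inl] at hk
  have h2 := (symbol_eq_some_iff.mp hk).mem_Icc
  exact fun x hx => ⟨h1.1.trans hx.1.le, hx.2.le.trans h2.2⟩

theorem image_openPiece {j : Fin m} {k : Fin n}
    (hk : F.symbol (pieceEnd b (Sum.inl j)) = some k) :
    F.image (openPiece b j) = F.branch k '' openPiece b j := by
  ext y
  constructor
  · rintro ⟨k', x, hx, hx', rfl⟩
    obtain rfl := (symbol_eq_some_iff.mp hk).unique (hb.inLap_of_mem_openPiece hx hx')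
    exact ⟨x, hx, rfl⟩
  · rintro ⟨x, hx, rfl⟩
    exact ⟨k, x, hx, hb.openPiece_subset hk hx, rfl⟩

theorem pieceWeight_eq {j : Fin m} {k : Fin n} (β : ℝ)
    (hk : F.symbol (pieceEnd b (Sum.inl j)) = some k) :
    F.pieceWeight b β j = |F.slope k| ^ (-β) := by
  rw [pieceWeight, Finset.sum_eq_single k, if_pos (hb.openPiece_subset hk)]
  · intro k' _ hne
    rw [if_neg]
    intro hsub
    obtain ⟨x, hx⟩ := hb.openPiece_nonempty j
    exact hne ((hb.inLap_of_mem_openPiece hx (hsub hx)).unique (symbol_eq_some_iff.mp hk))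
  · exact fun h => absurd (Finset.mem_univ k) h

theorem branch_mem_range {j : Fin m} {k : Fin n}
    (hk : F.symbol (pieceEnd b (Sum.inl j)) = some k) :
    F.branch k (b j.castSucc) ∈ Set.range b ∧ F.branch k (b j.succ) ∈ Set.range b := by
  rw [hb.2]
  have h1 := mem_orbitPoints_step (hb.pieceEnd_mem_orbitPoints (Sum.inl j))
  have h2 := mem_orbitPoints_step (hb.pieceEnd_mem_orbitPoints (Sum.inr j))
  rw [step_of_some hk] at h1
  rw [hb.symbol_pieceEnd_inl] at hk
  rw [step_of_some hk] at h2
  exact ⟨h1, h2⟩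

theorem le_castSucc_iff_of_mem_range {y : ℝ} (hy : y ∈ Set.range b) (i : Fin m) :
    y ≤ b i.castSucc ↔ ¬b i.succ ≤ y := by
  obtain ⟨u, rfl⟩ := hy
  rw [hb.1.le_iff_le, hb.1.le_iff_le, not_le, Fin.le_castSucc_iff]

open Classical in
/-- The entries of the weighted transition matrix count the passages of the boundary of an interval
over another one. -/
theorem weightedTransitionMatrix_eq (β : ℝ) (i j : Fin m) :
    F.weightedTransitionMatrix b β i j =
      F.weight β (F.symbol (pieceEnd b (Sum.inl j))) *
        ((if b i.succ ≤ (F.step (pieceEnd b (Sum.inr j))).1 then 1 else 0) -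
          if b i.succ ≤ (F.step (pieceEnd b (Sum.inl j))).1 then 1 else 0) := by
  rw [weightedTransitionMatrix, Matrix.mul_diagonal, transitionMatrix]
  rcases hs : F.symbol (pieceEnd b (Sum.inl j)) with _ | k
  · rw [if_neg]
    · simp [weight]
    · intro hsub
      obtain ⟨y, hy⟩ := hb.openPiece_nonempty i
      obtain ⟨k, x, hx, hx', -⟩ := hsub hy
      have := symbol_eq_some_iff.mpr (hb.inLap_of_mem_openPiece hx hx')
      rw [hs] at this
      exact absurd this (by simp)
  · have hbr := hb.branch_mem_range hs
    have hs' := hs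
    rw [hb.symbol_pieceEnd_inl] at hs'
    have hij := hb.1 (Fin.castSucc_lt_succ (i := i))
    have hjj := hb.1 (Fin.castSucc_lt_succ (i := j))
    have hsub := F.branch_sub k (b j.succ) (b j.castSucc)
    have himg := hb.image_openPiece hs
    rw [hb.pieceWeight_eq β hs, step_of_some hs, step_of_some hs']
    simp only [weight, pieceEnd, Sum.elim_inl, Sum.elim_inr]
    -- The images of the ends are Markov points. If `J i` is covered, the difference of indicators
    -- is the sign of the slope, which cancels the sign in the weight; otherwise it is 0.
    rcases lt_or_gt_of_ne (F.slope_ne_zero k) with hk | hk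
    · have hlt : F.branch k (b j.succ) < F.branch k (b j.castSucc) := by
        have := mul_neg_of_neg_of_pos hk (sub_pos.mpr hjj)
        linarith
      have hiff : openPiece b i ⊆ F.image (openPiece b j) ↔
          ¬b i.succ ≤ F.branch k (b j.succ) ∧ b i.succ ≤ F.branch k (b j.castSucc) := by
        rw [himg, openPiece, openPiece, F.image_branch_Ioo_of_neg hk, Set.Ioo_subset_Ioo_iff hij,
          hb.le_castSucc_iff_of_mem_range hbr.2]
      simp only [hiff, slopeSign_eq_neg_one hk]
      by_cases h1 : b i.succ ≤ F.branch k (b j.succ)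
      · simp [h1, h1.trans hlt.le]
      · by_cases h2 : b i.succ ≤ F.branch k (b j.castSucc) <;> simp [h1, h2]
    · have hlt : F.branch k (b j.castSucc) < F.branch k (b j.succ) := by
        have := mul_pos hk (sub_pos.mpr hjj)
        linarith
      have hiff : openPiece b i ⊆ F.image (openPiece b j) ↔
          ¬b i.succ ≤ F.branch k (b j.castSucc) ∧ b i.succ ≤ F.branch k (b j.succ) := by
        rw [himg, openPiece, openPiece, F.image_branch_Ioo_of_pos hk, Set.Ioo_subset_Ioo_iff hij,
          hb.le_castSucc_iff_of_mem_range hbr.1]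
      simp only [hiff, slopeSign_eq_one hk]
      by_cases h1 : b i.succ ≤ F.branch k (b j.castSucc)
      · simp [h1, h1.trans hlt.le]
      · by_cases h2 : b i.succ ≤ F.branch k (b j.succ) <;> simp [h1, h2]

open Classical in
theorem partitionCoord_inl (i : Fin m) (x : Fin m ⊕ Fin m) :
    partitionCoord ℝ⟦X⟧ m (Sum.inl i) x = if b i.succ ≤ (pieceEnd b x).1 then 1 else 0 := by
  rcases x with k | k
  · simp [partitionCoord, pieceEnd, hb.1.le_iff_le, Fin.succ_le_castSucc_iff]
  · simp [partitionCoord, pieceEnd, hb.1.le_iff_le]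

open Classical in
theorem partitionCoord_inr (i : Fin m) (x : Fin m ⊕ Fin m) :
    partitionCoord ℝ⟦X⟧ m (Sum.inr i) x =
      if b i.castSucc < (pieceEnd b x).1 ∨ b i.castSucc = (pieceEnd b x).1 ∧ (pieceEnd b x).2 = 1
      then 1 else 0 := by
  rcases x with k | k
  · simp [partitionCoord, pieceEnd, ← le_iff_lt_or_eq, hb.1.le_iff_le]
  · simp [partitionCoord, pieceEnd, hb.1.lt_iff_lt, ← Fin.le_castSucc_iff,
      show (-1 : ℤˣ) ≠ 1 by decide]

/-! ### The discontinuities -/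

theorem exists_cut (k : Fin (n + 1)) : ∃ i : Fin m, b i.castSucc = F.a k.castSucc := by
  obtain ⟨x, hx⟩ := hb.exists_pieceEnd_eq (p := (F.a k.castSucc, 1))
    (Or.inl ⟨rfl, F.strictMono_a.monotone (Fin.zero_le _),
      F.strictMono_a (Fin.castSucc_lt_last k)⟩) (F.a_mem_orbitPoints _)
  rcases x with i | i
  · exact ⟨i, congrArg Prod.fst hx⟩
  · exact absurd (congrArg Prod.snd hx) (by simp [pieceEnd])

/-- The index of the left end point of a piece in the Markov partition. -/
def cut (k : Fin (n + 1)) : Fin m := (hb.exists_cut k).choose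

theorem b_cut (k : Fin (n + 1)) : b (hb.cut k).castSucc = F.a k.castSucc :=
  (hb.exists_cut k).choose_spec

theorem cut_injective : Function.Injective hb.cut := by
  intro k l h
  have h1 := hb.b_cut k
  rw [h, hb.b_cut l] at h1
  exact (Fin.castSucc_injective _ (F.strictMono_a.injective h1)).symm

theorem b_zero : b 0 = F.a 0 := by
  obtain ⟨u, hu⟩ := hb.2.symm ▸ F.a_mem_orbitPoints 0
  refine le_antisymm ?_ (F.orbitPoints_subset (hb.mem_orbitPoints 0)).1
  rw [← hu]
  exact hb.1.monotone (Fin.zero_le u)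

theorem cut_zero : (hb.cut 0 : ℕ) = 0 := by
  have h := hb.b_cut 0
  rw [Fin.castSucc_zero, ← hb.b_zero] at h
  exact congrArg Fin.val (hb.1.injective h)

theorem exists_pred_cut_succ (l : Fin n) : ∃ i : Fin m, (i : ℕ) + 1 = hb.cut l.succ := by
  have h : (hb.cut l.succ : ℕ) ≠ 0 := by
    rw [← hb.cut_zero]
    exact fun h => (Fin.succ_ne_zero l) (hb.cut_injective (Fin.ext h))
  exact ⟨⟨hb.cut l.succ - 1, by omega⟩, by simp only; omega⟩

theorem notMem_range_cut {i : Fin m} (hi : i ∉ Set.range hb.cut) :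
    b i.castSucc ∉ Set.range F.a ∧ ∃ l : Fin m, (l : ℕ) + 1 = i := by
  constructor
  · rintro ⟨k, hk⟩
    rcases Fin.eq_castSucc_or_eq_last k with ⟨k, rfl⟩ | rfl
    · refine hi ⟨k, ?_⟩
      rw [← hb.b_cut k] at hk
      exact Fin.castSucc_injective _ (hb.1.injective hk)
    · have h := hb.1 (Fin.castSucc_lt_succ (i := i))
      rw [← hk] at h
      exact absurd (F.orbitPoints_subset (hb.mem_orbitPoints i.succ)).2 (not_le.mpr h)
  · have h : (i : ℕ) ≠ 0 := by
      rw [← hb.cut_zero]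
      exact fun h => hi ⟨0, Fin.ext h.symm⟩
    exact ⟨⟨i - 1, by omega⟩, by simp only; omega⟩

omit hb in
theorem pieceEnd_inr_eq {l i : Fin m} (h : (l : ℕ) + 1 = i) :
    pieceEnd b (Sum.inr l) = (b i.castSucc, -1) := by
  have : l.succ = i.castSucc := Fin.ext (by simpa using h)
  simp [pieceEnd, this]

end IsMarkovPartition

end

end HoleMap

namespace HoleMap

noncomputable section

variable {n : ℕ} {F : HoleMap n} {m : ℕ} {b : Fin (m + 1) → ℝ}

namespace IsMarkovPartition

open Matrix

variable (hb : F.IsMarkovPartition b)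
include hb

/-! ### The action on the basis of the partition -/

/-- The weighted action on lateral end points, with values in the coordinates of the partition. -/
def actionMatrix (β : ℝ) : Matrix (Fin m ⊕ Fin m) (Fin m ⊕ Fin m) ℝ⟦X⟧ :=
  partitionCoord ℝ⟦X⟧ m * hb.lateralMatrix β * partitionBasis ℝ⟦X⟧ m

theorem coord_mul_lateralMatrix (β : ℝ) (x y : Fin m ⊕ Fin m) :
    (partitionCoord ℝ⟦X⟧ m * hb.lateralMatrix β) x y = partitionCoord ℝ⟦X⟧ m x (hb.next y) *
      (PowerSeries.C (F.weight β (F.symbol (pieceEnd b y))) * PowerSeries.X) :=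
  mul_ofWeightedMap_apply _ _ _ _ _

open Classical in
theorem coord_inl_next (i : Fin m) (y : Fin m ⊕ Fin m) :
    partitionCoord ℝ⟦X⟧ m (Sum.inl i) (hb.next y) =
      if b i.succ ≤ (F.step (pieceEnd b y)).1 then 1 else 0 := by
  rw [hb.partitionCoord_inl, hb.pieceEnd_next, representative_fst]

theorem actionMatrix_inl_inl (β : ℝ) (i j : Fin m) :
    hb.actionMatrix β (Sum.inl i) (Sum.inl j) =
      PowerSeries.X * PowerSeries.C (F.weightedTransitionMatrix b β i j) := by
  rw [actionMatrix, mul_partitionBasis_inl, coord_mul_lateralMatrix, coord_mul_lateralMatrix,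
    coord_inl_next, coord_inl_next, hb.weightedTransitionMatrix_eq, ← hb.symbol_pieceEnd_inl]
  split_ifs <;> simp [mul_comm]

/-- The two sides of a Markov point that does not cut two pieces. -/
theorem symbol_pieceEnd_inr {i l : Fin m} (hi : i ∉ Set.range hb.cut) (hl : (l : ℕ) + 1 = i) :
    F.symbol (pieceEnd b (Sum.inr l)) = F.symbol (pieceEnd b (Sum.inl i)) := by
  rw [pieceEnd_inr_eq hl]
  exact (symbol_sides (hb.notMem_range_cut hi).1).symm

/-- Both sides of the point have the same image point, and the `inl` coordinates do not see the
side. -/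
theorem actionMatrix_inl_inr (β : ℝ) (i : Fin m) {j : Fin m} (hj : j ∉ Set.range hb.cut) :
    hb.actionMatrix β (Sum.inl i) (Sum.inr j) = 0 := by
  obtain ⟨l, hl⟩ := (hb.notMem_range_cut hj).2
  have hsym := hb.symbol_pieceEnd_inr hj hl
  rw [actionMatrix, mul_partitionBasis_inr_succ _ _ hl, coord_mul_lateralMatrix,
    coord_mul_lateralMatrix, coord_inl_next, coord_inl_next, hsym]
  rcases hs : F.symbol (pieceEnd b (Sum.inl j)) with _ | k
  · simp [weight]
  · rw [step_of_some hs, step_of_some (hsym.trans hs), pieceEnd_inr_eq hl]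
    exact sub_self _

end IsMarkovPartition

variable (F) in
/-- The first time at which the itineraries of the two sides of `x` differ. -/
def separationTime (x : ℝ) : ℕ := sInf {k | F.itinerary (x, 1) k ≠ F.itinerary (x, -1) k}

theorem separationTime_branch_lt {x : ℝ} {k : Fin n} (hx : ¬F.SidesAgree x)
    (h1 : F.symbol (x, 1) = some k) (h2 : F.symbol (x, -1) = some k) :
    F.separationTime (F.branch k x) < F.separationTime x := by
  have hne : {k | F.itinerary (x, 1) k ≠ F.itinerary (x, -1) k}.Nonempty := by
    by_contra hcon
    exact hx (funext fun k => by
      by_contra hk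
      exact hcon ⟨k, hk⟩)
  have hmem := Nat.sInf_mem hne
  change F.itinerary (x, 1) (F.separationTime x) ≠ F.itinerary (x, -1) (F.separationTime x) at hmem
  rcases ht : F.separationTime x with _ | t
  · rw [ht] at hmem
    exact absurd (h1.trans h2.symm) hmem
  · rw [ht] at hmem
    exact Nat.lt_succ_of_le (Nat.sInf_le fun h => hmem ((itinerary_branch_sides h1 h2 t).mp h))

namespace IsMarkovPartition

open Matrix

variable (hb : F.IsMarkovPartition b)
include hb

/-- The jump at `b j` has a jump coordinate only at its image point, and none if its sides agree,
since they are then sent to the same representative. This makes the jump block at the points other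
than cuts nilpotent. -/
theorem separationTime_lt (β : ℝ) {i j : Fin m} (hj : j ∉ Set.range hb.cut)
    (h : hb.actionMatrix β (Sum.inr i) (Sum.inr j) ≠ 0) :
    F.separationTime (b i.castSucc) < F.separationTime (b j.castSucc) := by
  obtain ⟨l, hl⟩ := (hb.notMem_range_cut hj).2
  have hsym := hb.symbol_pieceEnd_inr hj hl
  rw [actionMatrix, mul_partitionBasis_inr_succ _ _ hl, coord_mul_lateralMatrix,
    coord_mul_lateralMatrix, hsym] at h
  rcases hs : F.symbol (pieceEnd b (Sum.inl j)) with _ | k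
  · simp [hs, weight] at h
  have h1 : F.symbol (b j.castSucc, 1) = some k := hs
  have h2 : F.symbol (b j.castSucc, -1) = some k := by
    rw [← pieceEnd_inr_eq hl]; exact hsym.trans hs
  have hnL : pieceEnd b (hb.next (Sum.inl j)) =
      F.representative (F.step (b j.castSucc, 1)) := hb.pieceEnd_next _
  have hnR : pieceEnd b (hb.next (Sum.inr l)) =
      F.representative (F.step (b j.castSucc, -1)) := by
    rw [hb.pieceEnd_next, pieceEnd_inr_eq hl]
  by_cases hag : F.SidesAgree (b j.castSucc)
  · rw [hag.representative_step h1, ← hnR] at hnL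
    rw [pieceEnd_injective hb.1 hnL, sub_self] at h
    exact absurd rfl h
  · have hag' := mt (sidesAgree_branch_iff h1 h2).mp hag
    rw [hb.partitionCoord_inr, hb.partitionCoord_inr, hnL, hnR] at h
    have hy : b i.castSucc = F.branch k (b j.castSucc) := by
      by_contra hne
      refine h ?_
      rcases step_side h1 h2 with ⟨h3, h4⟩ | ⟨h3, h4⟩ <;>
        simp [h3, h4, representative, hag', hne]
    rw [hy]
    exact separationTime_branch_lt hag h1 h2

/-- The selection of the columns of the partition basis at the left end points of the pieces. -/
def cutSelection : Matrix (Fin (n + 1)) (Fin m ⊕ Fin m) ℝ⟦X⟧ :=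
  columnSelection ℝ⟦X⟧ fun k => Sum.inr (hb.cut k)

theorem mul_cutSelection_transpose_apply {Y : Type*} (M : Matrix Y (Fin m ⊕ Fin m) ℝ⟦X⟧) (y : Y)
    (k : Fin (n + 1)) : (M * hb.cutSelectionᵀ) y k = M y (Sum.inr (hb.cut k)) :=
  mul_columnSelection_transpose_apply _ M y k

open Classical in
theorem mul_cutSelection_apply {Y : Type*} (M : Matrix Y (Fin m ⊕ Fin m) ℝ⟦X⟧) (y : Y)
    (x : Fin m ⊕ Fin m) : (M * hb.cutSelectionᵀ * hb.cutSelection) y x =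
      if x ∈ Set.range (fun k => Sum.inr (hb.cut k)) then M y x else 0 :=
  mul_columnSelection_apply (Sum.inr_injective.comp hb.cut_injective) M y x

/-- In the coordinates of the partition the columns at the cuts have become unit vectors. The jump
columns then have no boundary components, and the matrix is block lower triangular with diagonal
blocks 1 - tQ and a unipotent one. -/
theorem det_modified (β : ℝ) :
    (partitionCoord ℝ⟦X⟧ m * ((1 - hb.lateralMatrix β) * partitionBasis ℝ⟦X⟧ m +
      hb.lateralMatrix β * partitionBasis ℝ⟦X⟧ m * hb.cutSelectionᵀ * hb.cutSelection)).det =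
    (1 - (PowerSeries.X : ℝ⟦X⟧) • (F.weightedTransitionMatrix b β).map PowerSeries.C).det := by
  classical
  have h1 : partitionCoord ℝ⟦X⟧ m * ((1 - hb.lateralMatrix β) * partitionBasis ℝ⟦X⟧ m +
      hb.lateralMatrix β * partitionBasis ℝ⟦X⟧ m * hb.cutSelectionᵀ * hb.cutSelection) =
      1 - hb.actionMatrix β + hb.actionMatrix β * hb.cutSelectionᵀ * hb.cutSelection := by
    rw [Matrix.mul_add, Matrix.sub_mul, Matrix.mul_sub, Matrix.one_mul,
      partitionCoord_mul_partitionBasis, actionMatrix]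
    simp only [Matrix.mul_assoc]
  let N : Matrix (Fin m) (Fin m) ℝ⟦X⟧ := of fun i j =>
    if j ∈ Set.range hb.cut then 0 else hb.actionMatrix β (Sum.inr i) (Sum.inr j)
  have hN : ∀ i j, N i j =
      if j ∈ Set.range hb.cut then 0 else hb.actionMatrix β (Sum.inr i) (Sum.inr j) :=
    fun _ _ => rfl
  have h2 : 1 - hb.actionMatrix β + hb.actionMatrix β * hb.cutSelectionᵀ * hb.cutSelection = fromBlocks
      (1 - (PowerSeries.X : ℝ⟦X⟧) • (F.weightedTransitionMatrix b β).map PowerSeries.C) 0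
      (of fun i j => -hb.actionMatrix β (Sum.inr i) (Sum.inl j)) (1 - N) := by
    ext x y : 1
    rw [Matrix.add_apply, Matrix.sub_apply, hb.mul_cutSelection_apply]
    rcases y with j | j
    · rw [if_neg (by simp), add_zero]
      rcases x with i | i
      · rw [fromBlocks_apply₁₁, hb.actionMatrix_inl_inl]
        simp [one_apply]
      · simp [one_apply]
    · have hmem : (Sum.inr j : Fin m ⊕ Fin m) ∈ Set.range (fun k => Sum.inr (hb.cut k)) ↔
          j ∈ Set.range hb.cut := by simp
      simp only [hmem]
      rcases x with i | i
      · rw [fromBlocks_apply₁₂]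
        split_ifs with h
        · simp
        · simp [hb.actionMatrix_inl_inr β i h]
      · rw [fromBlocks_apply₂₂]
        by_cases h : j ∈ Set.range hb.cut
        · rw [Matrix.sub_apply, hN, if_pos h, if_pos h]
          simp [one_apply]
        · rw [Matrix.sub_apply, hN, if_neg h, if_neg h]
          simp [one_apply]
  rw [h1, h2, det_fromBlocks_zero₁₂,
    det_one_sub_of_rank N fun i => F.separationTime (b i.castSucc), mul_one]
  intro i j hij
  by_cases hj : j ∈ Set.range hb.cut
  · exact absurd ((hN i j).trans (if_pos hj)) hij
  · exact hb.separationTime_lt β hj fun h => hij ((hN i j).trans ((if_neg hj).trans h))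

/-! ### The invariant coordinates of the lateral end points -/

omit hb in
variable (F b) in
/-- The invariant coordinates of the lateral end points of the Markov intervals. -/
def thetaMatrix (β : ℝ) : Matrix (Fin (n + 1)) (Fin m ⊕ Fin m) ℝ⟦X⟧ := of fun s x =>
  F.thetaSymbol β (pieceEnd b x) (finSuccEquiv' F.hole s)

/-- The indicators of the pieces, obtained from the invariant coordinates. -/
def symbolMatrix (β : ℝ) : Matrix (Fin (n + 1)) (Fin m ⊕ Fin m) ℝ⟦X⟧ :=
  thetaMatrix F b β *
    (1 - hb.lateralMatrix β : Matrix (Fin m ⊕ Fin m) (Fin m ⊕ Fin m) ℝ⟦X⟧)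

-- This is the recursion for the invariant coordinate; passing to the representative in `next` does
-- no harm because it keeps the itinerary.
open Classical in
theorem symbolMatrix_apply (β : ℝ) (s : Fin (n + 1)) (x : Fin m ⊕ Fin m) :
    hb.symbolMatrix β s x =
      if F.symbol (pieceEnd b x) = finSuccEquiv' F.hole s then 1 else 0 := by
  rw [symbolMatrix, Matrix.mul_sub, Matrix.mul_one, Matrix.sub_apply, lateralMatrix, mul_ofWeightedMap_apply,
    thetaMatrix, of_apply, of_apply, thetaSymbol_eq, hb.pieceEnd_next,
    thetaSymbol_congr (F.itinerary_representative _)]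
  ring

theorem symbolMatrix_mul_basis_inl (β : ℝ) (s : Fin (n + 1)) (i : Fin m) :
    (hb.symbolMatrix β * partitionBasis ℝ⟦X⟧ m) s (Sum.inl i) = 0 := by
  rw [mul_partitionBasis_inl, hb.symbolMatrix_apply, hb.symbolMatrix_apply, hb.symbol_pieceEnd_inl,
    sub_self]

theorem symbolMatrix_mul_basis_inr (β : ℝ) (s : Fin (n + 1)) {i : Fin m}
    (hi : i ∉ Set.range hb.cut) :
    (hb.symbolMatrix β * partitionBasis ℝ⟦X⟧ m) s (Sum.inr i) = 0 := by
  obtain ⟨l, hl⟩ := (hb.notMem_range_cut hi).2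
  rw [mul_partitionBasis_inr_succ _ _ hl, hb.symbolMatrix_apply, hb.symbolMatrix_apply,
    hb.symbol_pieceEnd_inr hi hl, sub_self]

theorem pieceEnd_cut (k : Fin (n + 1)) :
    pieceEnd b (Sum.inl (hb.cut k)) = (F.a k.castSucc, 1) := by
  rw [← hb.b_cut]; rfl

theorem pieceEnd_pred_cut {i : Fin m} {l : Fin n} (h : (i : ℕ) + 1 = hb.cut l.succ) :
    pieceEnd b (Sum.inr i) = (F.a l.succ.castSucc, -1) := by
  rw [pieceEnd_inr_eq h, hb.b_cut]

theorem symbolMatrix_mul_basis_cut_zero (β : ℝ) (s : Fin (n + 1)) :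
    (hb.symbolMatrix β * partitionBasis ℝ⟦X⟧ m) s
      (Sum.inr (hb.cut 0)) = if s = 0 then 1 else 0 := by
  rw [mul_partitionBasis_inr_zero _ _ hb.cut_zero, hb.symbolMatrix_apply, hb.pieceEnd_cut,
    (F.inPiece_castSucc 0).symbol_eq]
  simp [eq_comm]

theorem symbolMatrix_mul_basis_cut_succ (β : ℝ) (s : Fin (n + 1)) (l : Fin n) :
    (hb.symbolMatrix β * partitionBasis ℝ⟦X⟧ m) s
      (Sum.inr (hb.cut l.succ)) =
        (if s = l.succ then 1 else 0) - if s = l.castSucc then 1 else 0 := by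
  obtain ⟨i, hi⟩ := hb.exists_pred_cut_succ l
  have h := (F.inPiece_succ l.castSucc).symbol_eq
  rw [Fin.succ_castSucc] at h
  rw [mul_partitionBasis_inr_succ _ _ hi, hb.symbolMatrix_apply, hb.symbolMatrix_apply, hb.pieceEnd_cut,
    (F.inPiece_castSucc l.succ).symbol_eq, hb.pieceEnd_pred_cut hi, h]
  simp [eq_comm]

/-! ### From the transition matrix to the kneading determinant -/

/-- The invariant coordinates of the increments at the left end points of the pieces. -/
def incrementMatrix (β : ℝ) : Matrix (Fin (n + 1)) (Fin (n + 1)) ℝ⟦X⟧ :=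
  thetaMatrix F b β * partitionBasis ℝ⟦X⟧ m *
    hb.cutSelectionᵀ

theorem det_transition_eq (β : ℝ) :
    (1 - (PowerSeries.X : ℝ⟦X⟧) • (F.weightedTransitionMatrix b β).map PowerSeries.C).det =
      (F.cyclotomicProduct β : ℝ⟦X⟧) * (hb.incrementMatrix β).det := by
  classical
  have hdet : (partitionCoord ℝ⟦X⟧ m).det * (partitionBasis ℝ⟦X⟧ m).det = 1 := by
    rw [← det_mul, partitionCoord_mul_partitionBasis, det_one]
  have key := det_mul_det_of_selection (hb.lateralMatrix β) (partitionBasis ℝ⟦X⟧ m)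
    hb.cutSelection (thetaMatrix F b β)
    (IsUnit.of_mul_eq_one_right _ hdet)
    (by rw [hb.det_one_sub_lateralMatrix]; exact isUnit_cyclotomicProduct β) (by
      ext s y : 1
      change (hb.symbolMatrix β * partitionBasis ℝ⟦X⟧ m * hb.cutSelectionᵀ * hb.cutSelection) s y =
        (hb.symbolMatrix β * partitionBasis ℝ⟦X⟧ m) s y
      rw [hb.mul_cutSelection_apply]
      split_ifs with h
      · rfl
      · rcases y with i | i
        · rw [hb.symbolMatrix_mul_basis_inl]
        · rw [hb.symbolMatrix_mul_basis_inr]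
          rintro ⟨k, rfl⟩
          exact h ⟨k, rfl⟩)
  -- Crossing the left end of a piece replaces the symbol of the preceding piece by its own, so this
  -- matrix is upper unitriangular.
  have hU : (hb.symbolMatrix β * partitionBasis ℝ⟦X⟧ m *
      hb.cutSelectionᵀ).det = 1 := by
    rw [det_of_isUpperTriangular]
    · refine Finset.prod_eq_one fun k _ => ?_
      rw [hb.mul_cutSelection_transpose_apply]
      rcases Fin.eq_zero_or_eq_succ k with rfl | ⟨l, rfl⟩
      · simp [hb.symbolMatrix_mul_basis_cut_zero]
      · simp [hb.symbolMatrix_mul_basis_cut_succ, Fin.castSucc_lt_succ.ne']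
    · intro s k hks
      simp only [id] at hks
      rw [hb.mul_cutSelection_transpose_apply]
      rcases Fin.eq_zero_or_eq_succ k with rfl | ⟨l, rfl⟩
      · simp [hb.symbolMatrix_mul_basis_cut_zero, hks.ne']
      · simp [hb.symbolMatrix_mul_basis_cut_succ, hks.ne', (Fin.castSucc_lt_succ.trans hks).ne']
  rw [← symbolMatrix, hU, one_mul, hb.det_one_sub_lateralMatrix] at key
  rw [← hb.det_modified, det_mul, key, incrementMatrix]
  linear_combination (F.cyclotomicProduct β : ℝ⟦X⟧) * (thetaMatrix F b β *
    partitionBasis ℝ⟦X⟧ m * hb.cutSelectionᵀ).det * hdet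

theorem incrementMatrix_zero (β : ℝ) (s : Fin (n + 1)) : hb.incrementMatrix β s 0 =
    F.thetaSymbol β (F.a (Fin.castSucc 0), 1) (finSuccEquiv' F.hole s) := by
  rw [incrementMatrix, hb.mul_cutSelection_transpose_apply,
    mul_partitionBasis_inr_zero _ _ hb.cut_zero, thetaMatrix, of_apply, hb.pieceEnd_cut]

theorem incrementMatrix_succ (β : ℝ) (s : Fin (n + 1)) (l : Fin n) :
    hb.incrementMatrix β s l.succ =
      F.thetaSymbol β (F.a l.succ.castSucc, 1) (finSuccEquiv' F.hole s) -
        F.thetaSymbol β (F.a l.succ.castSucc, -1) (finSuccEquiv' F.hole s) := by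
  obtain ⟨i, hi⟩ := hb.exists_pred_cut_succ l
  rw [incrementMatrix, hb.mul_cutSelection_transpose_apply,
    mul_partitionBasis_inr_succ _ _ hi, thetaMatrix, of_apply, of_apply, hb.pieceEnd_cut,
    hb.pieceEnd_pred_cut hi]

/-- The combination of rows with coefficients 1 - κ_s t is 1 at the column of a_0, which holds a
single coordinate, and 0 at the others, which hold differences. The coefficient of the hole is 1 as
its weight is 0, so this combination can replace the row of the hole. -/
theorem det_incrementMatrix (β : ℝ) : (hb.incrementMatrix β).det = (-1) ^ (F.hole : ℕ) *
    ((hb.incrementMatrix β).submatrix F.hole.succAbove Fin.succ).det := by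
  set T := hb.incrementMatrix β with hT
  let c : Fin (n + 1) → ℝ⟦X⟧ := fun s =>
    1 - PowerSeries.C (F.weight β (finSuccEquiv' F.hole s)) * PowerSeries.X
  have hsum : ∀ p, ∑ s, c s * F.thetaSymbol β p (finSuccEquiv' F.hole s) = 1 := fun p =>
    (Equiv.sum_comp (finSuccEquiv' F.hole) fun o =>
      (1 - PowerSeries.C (F.weight β o) * PowerSeries.X) * F.thetaSymbol β p o).trans
      (F.sum_thetaSymbol β p)
  have hrow : ∑ s, c s • T s = Pi.single 0 1 := by
    ext1 k
    rw [Finset.sum_apply]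
    simp only [Pi.smul_apply, smul_eq_mul]
    rcases Fin.eq_zero_or_eq_succ k with rfl | ⟨l, rfl⟩
    · simp only [hT, hb.incrementMatrix_zero, hsum, Pi.single_eq_same]
    · simp only [hT, hb.incrementMatrix_succ, mul_sub, Finset.sum_sub_distrib, hsum, sub_self]
      simp
  have h0 := det_updateRow_sum T F.hole c
  have hc : c F.hole = 1 := by simp [c, weight]
  rw [hrow, hc, one_smul] at h0
  rw [← h0, det_succ_row _ F.hole, Fintype.sum_eq_single 0]
  · simp [submatrix_updateRow_succAbove, Fin.succAbove_zero]
  · intro k hk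
    simp [hk]

end IsMarkovPartition

/-- The invariant coordinate of a lateral point in the hole has no coefficient at a lap. -/
theorem theta_of_symbol_eq_none {p : ℝ × ℤˣ} (h : F.symbol p = none) (β : ℝ) (j : Fin n) :
    F.theta β p j = 0 := by
  ext k
  simp [theta, itinerary_of_none h]

theorem IsMarkovPartition.kneadingDet_eq (hb : F.IsMarkovPartition b) (β : ℝ) :
    F.kneadingDet β = (-1) ^ ((F.hole : ℕ) - 1) * (hb.incrementMatrix β).det := by
  obtain ⟨i₀, hi₀⟩ := Fin.exists_succ_eq.mpr F.hole_pos.ne'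
  have hnone : F.symbol (F.a F.hole.castSucc, 1) = none := by
    rw [(F.inPiece_castSucc F.hole).symbol_eq, finSuccEquiv'_at]
  have hnone' : F.symbol (F.a F.hole.succ, -1) = none := by
    rw [(F.inPiece_succ F.hole).symbol_eq, finSuccEquiv'_at]
  have hT : ((hb.incrementMatrix β).submatrix F.hole.succAbove Fin.succ).transpose =
      -- At a_h the right side is in the hole and has no coefficient at a lap, so the increment is
      -- -θ(a_h⁻), while the kneading matrix uses +θ(a_h⁻). At a_{h+1} the term from the hole
      -- vanishes without a change of sign.
      (F.kneadingMatrix β).updateRow i₀ ((-1 : ℝ⟦X⟧) • F.kneadingMatrix β i₀) := by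
    ext i j : 1
    rw [Matrix.transpose_apply, Matrix.submatrix_apply, hb.incrementMatrix_succ,
      finSuccEquiv'_succAbove, thetaSymbol_some, thetaSymbol_some]
    by_cases hi : i = i₀
    · subst hi
      rw [Matrix.updateRow_self, Pi.smul_apply, kneadingMatrix, if_pos (by rw [hi₀]), hi₀,
        theta_of_symbol_eq_none hnone]
      simp
    · have h1 : ¬i.succ.castSucc = F.hole.castSucc := fun h =>
        hi (Fin.succ_injective _ ((Fin.castSucc_injective _ h).trans hi₀.symm))
      rw [Matrix.updateRow_ne hi, kneadingMatrix, if_neg h1]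
      split_ifs with h2
      · rw [h2, theta_of_symbol_eq_none hnone', sub_zero]
      · rfl
  have hdet : ((hb.incrementMatrix β).submatrix F.hole.succAbove Fin.succ).det =
      -F.kneadingDet β := by
    rw [← Matrix.det_transpose, hT, Matrix.det_updateRow_smul, Matrix.updateRow_eq_self,
      kneadingDet, neg_one_mul]
  obtain ⟨h, hh'⟩ : ∃ h, (F.hole : ℕ) = h + 1 := ⟨i₀, by rw [← hi₀, Fin.val_succ]⟩
  rw [hb.det_incrementMatrix, hdet, hh', Nat.add_sub_cancel, pow_succ]
  have : ((-1 : ℝ⟦X⟧) ^ h) * (-1) ^ h = 1 := by rw [← mul_pow, neg_one_mul, neg_neg, one_pow]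
  linear_combination -(F.kneadingDet β) * this

end

end HoleMap

/-- The existential over `m` and `b` loses nothing: `IsMarkovPartition` determines both, as the
increasing enumeration of a given finite set. -/
theorem theorem2 {n : ℕ} (F : HoleMap n) (β : ℝ)
    (hF : ∀ q : Fin n × ℤˣ,
      F.EventuallyPeriodic (F.lateral q) ∨ F.FallsIntoHole (F.lateral q)) :
    IsUnit (F.cyclotomicProduct β : PowerSeries ℝ) ∧
    ∃ (m : ℕ) (b : Fin (m + 1) → ℝ), F.IsMarkovPartition b ∧
      F.kneadingDet β =
        (-1) ^ ((F.hole : ℕ) - 1) *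
          ((Matrix.det (1 - (Polynomial.X : Polynomial ℝ) •
            (F.weightedTransitionMatrix b β).map Polynomial.C) : Polynomial ℝ) : PowerSeries ℝ) *
          (F.cyclotomicProduct β : PowerSeries ℝ)⁻¹ := by
  have hunit := HoleMap.isUnit_cyclotomicProduct (F := F) β
  refine ⟨hunit, ?_⟩
  obtain ⟨m, b, hb⟩ := F.exists_isMarkovPartition hF
  refine ⟨m, b, hb, ?_⟩
  have hcoe : ((Matrix.det (1 - (Polynomial.X : Polynomial ℝ) •
      (F.weightedTransitionMatrix b β).map Polynomial.C) : Polynomial ℝ) : PowerSeries ℝ) =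
      (1 - (PowerSeries.X : PowerSeries ℝ) •
        (F.weightedTransitionMatrix b β).map PowerSeries.C).det := by
    refine ((Polynomial.coeToPowerSeries.ringHom (R := ℝ)).map_det _).trans
      (congrArg Matrix.det ?_)
    ext i j : 1
    by_cases h : i = j <;> simp [h] <;> exact mul_comm _ _
  have hinv : (F.cyclotomicProduct β : PowerSeries ℝ) *
      (F.cyclotomicProduct β : PowerSeries ℝ)⁻¹ = 1 :=
    PowerSeries.mul_inv_cancel _ (PowerSeries.isUnit_iff_constantCoeff.mp hunit).ne_zero
  rw [hcoe, hb.det_transition_eq, hb.kneadingDet_eq]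
  linear_combination -((-1) ^ ((F.hole : ℕ) - 1) * (hb.incrementMatrix β).det) * hinv
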